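/- Let $d\ge 2$ be an integer, $\hbar>0$ and $\lambda\in\mathbb R\setminus\{0\}$. Let $\mathbf M(a;b;z)=\sum_{n\ge 0}\frac{(a)_n}{\Gamma(b+n)\,n!}z^n$ be Olver's confluent hypergeometric function, and for $x\in\mathbb R^d$, $\theta\in\mathbb S^{d-1}$ let $$\psi_{\hbar,\lambda}(x;\theta)=c_{\hbar,\lambda}\,e^{\frac{i}{\hbar^2\lambda}x\cdot\theta}\,\mathbf M\Big(i\lambda;\ \tfrac{d-1}{2};\ \tfrac{i}{\hbar^2\lambda}(|x|-x\cdot\theta)\Big),\qquad c_{\hbar,\lambda}=|\lambda|^{\frac d2-1}\hbar^{\frac d2}\sqrt{2\pi},$$ be the perturbed plane wave of the Coulomb operator $-\frac{\hbar^2}{2}\Delta-\frac1{|x|}$ on $\mathbb R^d$. Let $$\mathscr H(\hbar,\lambda)=\Big\{x\mapsto\int_{\mathbb S^{d-1}}\psi_{\hbar,\lambda}(x;\theta)f(\theta)\,d\theta\ :\ f\in L^2(\mathbb S^{d-1})\Big\}$$ be the space of Coulomb generalized eigenfunctions with $L^2$ boundary data, where $d\theta$ is surface measure. On tempered distributions,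 extending from functions, let $$\mathcal F_\hbar[u]=\frac1{(2\pi\hbar)^{d/2}}\int_{\mathbb R^d}u(x)e^{-\frac i\hbar\langle x,\bullet\rangle}dx,\qquad \widehat{\mathcal D}_{\frac1{\hbar\lambda}}[u]=\frac1{|\hbar\lambda|^{d/2}}\,u\Big(\frac{\bullet}{\hbar\lambda}\Big).$$ Then for every $\psi\in\mathscr H(\hbar,\lambda)$: the function $\psi$ defines a tempered distribution (by integration against Schwartz functions); the tempered distribution $(\widehat{\mathcal D}_{\frac1{\hbar\lambda}}\circ\mathcal F_\hbar)[\psi]$ is given by a (necessarily unique) continuous function on $\{\xi\in\mathbb R^d:|\xi|\ne1\}$; and the pointwise values of this function satisfy $$(\widehat{\mathcal D}_{\frac1{\hbar\lambda}}\circ\mathcal F_\hbar)[\psi](\xi)=-\frac{e^{-\pi|\lambda|}}{|\xi|^{d+1}}\,(\widehat{\mathcal D}_{\frac1{\hbar\lambda}}\circ\mathcal F_\hbar)[\psi]\Big(\frac{\xi}{|\xi|^2}\Big)\qquad\text{whenever }0<|\xi|<1.$$ -/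

import Mathlib

open MeasureTheory SchwartzMap FourierTransform
open scoped Real

noncomputable section

namespace Coulomb

/-- Euclidean space `ℝ^d`. -/
abbrev Space (d : ℕ) : Type := EuclideanSpace ℝ (Fin d)

/-- The unit sphere `S^{d-1}` of `ℝ^d`. -/
abbrev Sphere (d : ℕ) : Type := Metric.sphere (0 : Space d) 1

/-- The (unnormalized) surface measure `dθ` on `S^{d-1}`. -/
abbrev sphereMeasure (d : ℕ) : Measure (Sphere d) := (volume : Measure (Space d)).toSphere

/-- Olver's (regularized) confluent hypergeometric function
`𝐌(a; b; z) = ∑ₙ (a)ₙ zⁿ / (Γ(b + n) n!)`. -/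
def olverM (a b z : ℂ) : ℂ :=
  ∑' n : ℕ, (ascPochhammer ℂ n).eval a / (Complex.Gamma (b + n) * (n.factorial : ℂ)) * z ^ n

/-- The normalization constant `c_{ħ,λ} = |λ|^{d/2 - 1} ħ^{d/2} √(2π)`. -/
def waveConst (d : ℕ) (hbar lam : ℝ) : ℝ :=
  |lam| ^ ((d : ℝ) / 2 - 1) * hbar ^ ((d : ℝ) / 2) * √(2 * π)

/-- The perturbed Coulomb plane wave
`ψ_{ħ,λ}(x; θ) = c_{ħ,λ} e^{i x·θ / (ħ²λ)} 𝐌(iλ; (d-1)/2; i(|x| - x·θ) / (ħ²λ))`. -/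
def planeWave (d : ℕ) (hbar lam : ℝ) (x : Space d) (θ : Sphere d) : ℂ :=
  (waveConst d hbar lam : ℂ)
    * Complex.exp (Complex.I * ((inner ℝ x (θ : Space d) / (hbar ^ 2 * lam) : ℝ) : ℂ))
    * olverM (Complex.I * (lam : ℂ)) (((d : ℂ) - 1) / 2)
        (Complex.I * (((‖x‖ - inner ℝ x (θ : Space d)) / (hbar ^ 2 * lam) : ℝ) : ℂ))

/-- The Poisson operator `f ↦ ∫_{S^{d-1}} ψ_{ħ,λ}(·; θ) f(θ) dθ` on `L²(S^{d-1})`. -/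
def poisson (d : ℕ) (hbar lam : ℝ) (f : Lp ℂ 2 (sphereMeasure d)) : Space d → ℂ :=
  fun x => ∫ θ, planeWave d hbar lam x θ * f θ ∂(sphereMeasure d)

/-- The space of Coulomb generalized eigenfunctions with `L²` boundary data. -/
def eigenspace (d : ℕ) (hbar lam : ℝ) : Set (Space d → ℂ) :=
  Set.range (poisson d hbar lam)

/-- Precomposition `φ ↦ φ(c ·)` of Schwartz functions with a nonzero dilation. -/
def schwartzScale (d : ℕ) (c : ℝ) (hc : c ≠ 0) : 𝓢(Space d, ℂ) →L[ℂ] 𝓢(Space d, ℂ) :=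
  SchwartzMap.compCLMOfContinuousLinearEquiv ℂ
    (ContinuousLinearEquiv.smulLeft (Units.mk0 c hc) : Space d ≃L[ℝ] Space d)

theorem schwartzScale_apply (d : ℕ) (c : ℝ) (hc : c ≠ 0) (φ : 𝓢(Space d, ℂ)) (x : Space d) :
    schwartzScale d c hc φ x = φ (c • x) := rfl

/-- The semiclassical Fourier transform
`φ ↦ (2πħ)^{-d/2} ∫ φ(x) e^{-i⟨x, ·⟩/ħ} dx` on Schwartz functions, written through Mathlib's
Fourier transform `∫ φ(x) e^{-2πi⟨x, ·⟩} dx`; see `schwartzFourier_apply`. -/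
def schwartzFourier (d : ℕ) (hbar : ℝ) (hpos : 0 < hbar) :
    𝓢(Space d, ℂ) →L[ℂ] 𝓢(Space d, ℂ) :=
  (((2 * π * hbar) ^ (-(d : ℝ) / 2) : ℝ) : ℂ) •
    (schwartzScale d (2 * π * hbar)⁻¹ (by positivity)).comp (fourierCLM ℂ 𝓢(Space d, ℂ))

theorem schwartzFourier_apply (d : ℕ) (hbar : ℝ) (hpos : 0 < hbar) (φ : 𝓢(Space d, ℂ))
    (ξ : Space d) :
    schwartzFourier d hbar hpos φ ξ =
      (((2 * π * hbar) ^ (-(d : ℝ) / 2) : ℝ) : ℂ) *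
        ∫ x, φ x * Complex.exp (-(Complex.I / hbar) * ((inner ℝ x ξ : ℝ) : ℂ)) := by
  have h1 : schwartzFourier d hbar hpos φ ξ =
      (((2 * π * hbar) ^ (-(d : ℝ) / 2) : ℝ) : ℂ) *
        (𝓕 (φ : Space d → ℂ)) ((2 * π * hbar)⁻¹ • ξ) := rfl
  rw [h1, Real.fourier_eq']
  congr 1
  refine integral_congr_ae (Filter.Eventually.of_forall fun x => ?_)
  simp only [smul_eq_mul]
  rw [mul_comm]
  congr 2
  have h2 : (hbar : ℂ) ≠ 0 := by exact_mod_cast hpos.ne'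
  have h3 : (π : ℂ) ≠ 0 := by exact_mod_cast Real.pi_ne_zero
  rw [inner_smul_right]
  push_cast
  field_simp

/-- The semiclassical Fourier transform `𝓕_ħ` of tempered distributions (by duality). -/
def semiclassicalFourier (d : ℕ) (hbar : ℝ) (hpos : 0 < hbar) :
    𝓢'(Space d, ℂ) →L[ℂ] 𝓢'(Space d, ℂ) :=
  PointwiseConvergenceCLM.precomp ℂ (schwartzFourier d hbar hpos)

/-- The unitary dilation `|c|^{-d/2} T(·/c)` of tempered distributions, for `c ≠ 0`; it is defined
by duality, see `dilation_eq_of_function` for its action on functions. -/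
def dilation (d : ℕ) (c : ℝ) (hc : c ≠ 0) : 𝓢'(Space d, ℂ) →L[ℂ] 𝓢'(Space d, ℂ) :=
  ((|c| ^ ((d : ℝ) / 2) : ℝ) : ℂ) • PointwiseConvergenceCLM.precomp ℂ (schwartzScale d c hc)

/-- The tempered distribution `T` is the function `u`: every `φ u` with `φ` Schwartz is integrable,
and `⟨T, φ⟩ = ∫ φ u`. -/
def IsFunction {d : ℕ} (T : 𝓢'(Space d, ℂ)) (u : Space d → ℂ) : Prop :=
  ∀ φ : 𝓢(Space d, ℂ), Integrable (fun x => φ x * u x) ∧ T φ = ∫ x, φ x * u x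

/-- On the open set `U` the tempered distribution `T` is the continuous function `g`: `g` is
continuous on `U` and `⟨T, φ⟩ = ∫ φ g` for every test function `φ` with compact support in `U`.
This determines `g` on `U`. -/
def EqOnOpen {d : ℕ} (T : 𝓢'(Space d, ℂ)) (g : Space d → ℂ) (U : Set (Space d)) : Prop :=
  ContinuousOn g U ∧
    ∀ φ : 𝓢(Space d, ℂ), HasCompactSupport φ → tsupport φ ⊆ U → T φ = ∫ ξ, φ ξ * g ξ

theorem dilation_eq_of_function (d : ℕ) (c : ℝ) (hc : c ≠ 0) (T : 𝓢'(Space d, ℂ))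
    (u : Space d → ℂ) (hT : IsFunction T u) :
    IsFunction (dilation d c hc T)
      (fun x => ((|c| ^ (-(d : ℝ) / 2) : ℝ) : ℂ) * u (c⁻¹ • x)) := by
  intro φ
  have key := hT (schwartzScale d c hc φ)
  have hfun : (fun x : Space d => φ x * ((((|c| ^ (-(d : ℝ) / 2) : ℝ) : ℂ)) * u (c⁻¹ • x))) =
      fun x => ((|c| ^ (-(d : ℝ) / 2) : ℝ) : ℂ) *
        (fun y => schwartzScale d c hc φ y * u y) (c⁻¹ • x) := by
    funext x
    simp only [schwartzScale_apply, smul_smul, mul_inv_cancel₀ hc, one_smul]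
    ring
  have hpos : 0 < |c| := abs_pos.mpr hc
  rw [hfun]
  refine ⟨((key.1).comp_smul (inv_ne_zero hc)).const_mul _, ?_⟩
  rw [integral_const_mul, Measure.integral_comp_smul volume
    (fun y => schwartzScale d c hc φ y * u y) c⁻¹, ← key.2]
  have h1 : dilation d c hc T φ =
      ((|c| ^ ((d : ℝ) / 2) : ℝ) : ℂ) * T (schwartzScale d c hc φ) := rfl
  rw [h1, Complex.real_smul, ← mul_assoc]
  congr 1
  rw [← Complex.ofReal_mul]
  congr 1
  rw [finrank_euclideanSpace_fin, inv_pow, inv_inv, abs_pow, ← Real.rpow_natCast,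
    ← Real.rpow_add hpos]
  congr 1
  ring

end Coulomb

end

/-! Write k = 1/(ħ²λ), a = iλ, b = (d-1)/2. Up to constants, the rescaled semiclassical Fourier
transform pairs with e^{-ikx·ξ}. Away from |ξ| = 1 it sends the plane wave of direction θ to a
multiple of (k²|θ-ξ|²)^{a-b} (k²(|ξ|²-1))^{-a-1}, where for |ξ| < 1 the second power is a boundary
value on the cut. Inversion ξ ↦ ξ/|ξ|² multiplies both |θ-ξ|² and |1-|ξ|²| by |ξ|⁻². The exponents
add up to -(d+1)/2, whence the power |ξ|^{d+1}, and the boundary value contributes -e^{-π|λ|}. No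
factor depends on θ, so the law passes to every superposition (`amplitude_inversion`).

The formula is found with a regularization e^{-ε|x|}. Subordination to Gaussians gives the transform
of e^{-m|x|}/|x| at complex frequencies (`integral_exp_neg_norm_div_norm`), hence the exponential
generating function of the parabolic coordinate and all its moments. Summing them against the series
of 𝐌 cancels the Gamma factors and leaves a binomial series, for large ε
(`integral_regKernel_mul_olverM_of_large`). The identity theorem extends the result to Re z > 0, and
differentiation in z removes the weight 1/|x| (`integral_exp_mul_coreWave_div_norm`).

Letting ε → 0 needs two bounds. An energy estimate for Kummer's equation bounds the plane waves
uniformly (`norm_olverM_le`); so ψ is bounded, hence tempered. The regularized amplitudes are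
bounded uniformly in ε and θ, locally uniformly off the unit sphere (`norm_regAmplitude_le`).
Dominated convergence then identifies the distribution (`integral_superpose_mul`). -/

namespace Coulomb

/-! ### Olver's function: series, Kummer's equation, bound on the imaginary axis. -/

/-- The Taylor coefficients `(a)ₙ / (Γ(b + n) n!)` of Olver's function. -/
noncomputable def olverCoeff (a b : ℂ) (n : ℕ) : ℂ :=
  (ascPochhammer ℂ n).eval a / (Complex.Gamma (b + n) * (n.factorial : ℂ))

theorem olverM_eq_tsum (a b z : ℂ) : olverM a b z = ∑' n, olverCoeff a b n * z ^ n := rfl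

theorem olverCoeff_succ_mul (a b : ℂ) (n : ℕ) :
    olverCoeff a b (n + 1) * (n + 1) = a * olverCoeff (a + 1) (b + 1) n := by
  have h : ((n : ℂ) + 1) ≠ 0 := Nat.cast_add_one_ne_zero n
  have h2 : (n.factorial : ℂ) ≠ 0 := by exact_mod_cast n.factorial_ne_zero
  have h3 : b + ((n : ℂ) + 1) = b + 1 + n := by ring
  simp only [olverCoeff, ascPochhammer_succ_left, Polynomial.eval_mul, Polynomial.eval_X,
    Polynomial.eval_comp, Polynomial.eval_add, Polynomial.eval_one, Nat.factorial_succ]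
  push_cast
  rw [h3]
  -- `Complex.Gamma` is 0 at its poles; there both quotients are 0 by the convention on division, so
  -- no condition on b is needed.
  by_cases hG : Complex.Gamma (b + 1 + n) = 0
  · simp [hG]
  field_simp

theorem olverCoeff_succ {a b : ℂ} (hb : 0 < b.re) (n : ℕ) :
    olverCoeff a b (n + 1) * ((b + n) * (n + 1)) = (a + n) * olverCoeff a b n := by
  have h : ((n : ℂ) + 1) ≠ 0 := Nat.cast_add_one_ne_zero n
  have h2 : (n.factorial : ℂ) ≠ 0 := by exact_mod_cast n.factorial_ne_zero
  have h3 : b + ((n : ℂ) + 1) = b + n + 1 := by ring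
  have hre : 0 < (b + n).re := by simp; positivity
  have hbn : b + n ≠ 0 := fun h => by simp [h] at hre
  have hG : Complex.Gamma (b + n) ≠ 0 := Complex.Gamma_ne_zero_of_re_pos hre
  simp only [olverCoeff, ascPochhammer_succ_eval, Nat.factorial_succ]
  push_cast
  rw [h3, Complex.Gamma_add_one _ hbn]
  field_simp

/-- Kummer's equation read off coefficientwise: the shift of both parameters by differentiation is
combined with the two-term recurrence at (a+1, b+1). -/
theorem olverCoeff_eq_sub {a b : ℂ} (hb : 0 < b.re) (n : ℕ) :
    olverCoeff a b (n + 1) =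
      (b + (n + 1)) * olverCoeff (a + 1) (b + 1) (n + 1) - olverCoeff (a + 1) (b + 1) n := by
  have h : ((n : ℂ) + 1) ≠ 0 := Nat.cast_add_one_ne_zero n
  have hb1 : 0 < (b + 1).re := by simp; positivity
  have h1 := olverCoeff_succ_mul a b n
  have h2 := olverCoeff_succ (a := a + 1) hb1 n
  apply mul_right_cancel₀ h
  linear_combination h1 - h2

theorem olverCoeff_zero_eq {a b : ℂ} (hb : 0 < b.re) :
    olverCoeff a b 0 = b * olverCoeff (a + 1) (b + 1) 0 := by
  have hb0 : b ≠ 0 := fun h => by simp [h] at hb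
  have hG : Complex.Gamma b ≠ 0 := Complex.Gamma_ne_zero_of_re_pos hb
  simp [olverCoeff, Complex.Gamma_add_one _ hb0]
  field_simp

theorem summable_norm_olverCoeff {a b : ℂ} (hb : 0 < b.re) {R : ℝ} (hR : 0 ≤ R) :
    Summable fun n => ‖olverCoeff a b n‖ * R ^ n := by
  apply summable_of_ratio_norm_eventually_le (r := 1 / 2) (by norm_num)
  -- For n > N this gives R(‖a‖ + n) ≤ (R + R‖a‖)n ≤ n(n+1)/2, hence a ratio of at most 1/2.
  obtain ⟨N, hN⟩ := exists_nat_ge (2 * R + 2 * R * ‖a‖)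
  filter_upwards [Filter.eventually_ge_atTop (N + 1)] with n hn
  have hn1 : (N : ℝ) + 1 ≤ n := by exact_mod_cast hn
  have hn0 : (0 : ℝ) < n := by have : (0 : ℝ) ≤ N := N.cast_nonneg; linarith
  have h1 := congrArg norm (olverCoeff_succ (a := a) hb n)
  simp only [norm_mul] at h1
  have h2 : (n : ℝ) ≤ ‖b + n‖ := by
    refine le_trans ?_ (Complex.re_le_norm _)
    simp; linarith
  have h3 : ‖(n : ℂ) + 1‖ = n + 1 := by
    have : ((n : ℂ) + 1) = ((n + 1 : ℕ) : ℂ) := by push_cast; ring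
    rw [this, Complex.norm_natCast]; push_cast; ring
  have h4 : ‖a + n‖ ≤ ‖a‖ + n := by
    refine (norm_add_le _ _).trans ?_
    rw [Complex.norm_natCast]
  rw [h3] at h1
  simp only [Real.norm_eq_abs, abs_mul, abs_norm, abs_pow, abs_of_nonneg hR]
  have h5 : ‖olverCoeff a b (n + 1)‖ * (n * (n + 1)) ≤ (‖a‖ + n) * ‖olverCoeff a b n‖ := by
    calc _ ≤ ‖olverCoeff a b (n + 1)‖ * (‖b + n‖ * (n + 1)) := by gcongr
      _ = _ := h1
      _ ≤ _ := by gcongr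
  have h6 : R * (‖a‖ + n) ≤ 1 / 2 * (n * (n + 1)) := by
    have h7 : 0 ≤ ‖a‖ := norm_nonneg a
    have : R * (‖a‖ + n) ≤ (R + R * ‖a‖) * n := by
      have h8 : 0 ≤ R * ‖a‖ := by positivity
      have : (1 : ℝ) ≤ n := by have : (0 : ℝ) ≤ N := N.cast_nonneg; linarith
      nlinarith
    nlinarith
  rw [pow_succ]
  have h8 : 0 < (n : ℝ) * (n + 1) := by positivity
  have h9 : R * ‖olverCoeff a b (n + 1)‖ ≤ 1 / 2 * ‖olverCoeff a b n‖ := by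
    refine le_of_mul_le_mul_right ?_ h8
    calc R * ‖olverCoeff a b (n + 1)‖ * (n * (n + 1))
        ≤ R * ((‖a‖ + n) * ‖olverCoeff a b n‖) := by rw [mul_assoc]; gcongr
      _ = (R * (‖a‖ + n)) * ‖olverCoeff a b n‖ := by ring
      _ ≤ (1 / 2 * (n * (n + 1))) * ‖olverCoeff a b n‖ := by gcongr
      _ = _ := by ring
  calc _ = (R * ‖olverCoeff a b (n + 1)‖) * R ^ n := by ring
    _ ≤ (1 / 2 * ‖olverCoeff a b n‖) * R ^ n := by gcongr
    _ = _ := by ring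

theorem summable_olverM {a b : ℂ} (hb : 0 < b.re) (z : ℂ) :
    Summable fun n => olverCoeff a b n * z ^ n := by
  refine Summable.of_norm ?_
  simpa only [norm_mul, norm_pow] using summable_norm_olverCoeff hb (norm_nonneg z)

theorem hasDerivAt_olverM {a b : ℂ} (hb : 0 < b.re) (z : ℂ) :
    HasDerivAt (olverM a b) (a * olverM (a + 1) (b + 1) z) z := by
  have hb1 : 0 < (b + 1).re := by simp; positivity
  set R : ℝ := ‖z‖ + 1 with hR
  have hR0 : 0 < R := by positivity
  have key : ∀ (n : ℕ) (y : ℂ), olverCoeff a b (n + 1) * (((n + 1 : ℕ) : ℂ) * y ^ n) =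
      a * (olverCoeff (a + 1) (b + 1) n * y ^ n) := by
    intro n y
    push_cast
    rw [← mul_assoc, olverCoeff_succ_mul, mul_assoc]
  have hu : Summable fun n : ℕ => ‖olverCoeff a b n‖ * (n * R ^ (n - 1)) := by
    rw [← summable_nat_add_iff 1]
    refine ((summable_norm_olverCoeff (a := a + 1) hb1 hR0.le).mul_left ‖a‖).congr fun n => ?_
    have := congrArg norm (key n (R : ℂ))
    simp only [norm_mul, norm_pow, Complex.norm_natCast, Complex.norm_real, Real.norm_eq_abs,
      abs_of_pos hR0] at this
    simpa using this.symm
  have hd := hasDerivAt_tsum_of_isPreconnected (𝕜 := ℂ)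
    (g := fun n z => olverCoeff a b n * z ^ n)
    (g' := fun n z => olverCoeff a b n * (n * z ^ (n - 1))) hu
    (t := Metric.ball (0 : ℂ) R) Metric.isOpen_ball (convex_ball _ _).isPreconnected
    (fun n y _ => (hasDerivAt_pow n y).const_mul _)
    (fun n y hy => by
      rw [mem_ball_zero_iff] at hy
      simp only [norm_mul, norm_pow, Complex.norm_natCast]
      gcongr)
    (y₀ := 0) (by simpa using hR0) (summable_olverM hb 0) (y := z) (by simp [hR])
  have hs : Summable fun n : ℕ => olverCoeff a b n * ((n : ℂ) * z ^ (n - 1)) := by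
    refine Summable.of_norm_bounded hu fun n => ?_
    simp only [norm_mul, norm_pow, Complex.norm_natCast]
    gcongr
    simp [hR]
  have he : ∑' n : ℕ, olverCoeff a b n * ((n : ℂ) * z ^ (n - 1)) =
      a * olverM (a + 1) (b + 1) z := by
    rw [hs.tsum_eq_zero_add]
    simp only [Nat.cast_zero, zero_mul, mul_zero, zero_add, Nat.add_sub_cancel, key]
    rw [tsum_mul_left, olverM_eq_tsum]
  rw [← he]
  exact hd

theorem continuous_olverM {a b : ℂ} (hb : 0 < b.re) : Continuous (olverM a b) :=
  continuous_iff_continuousAt.2 fun z => (hasDerivAt_olverM hb z).continuousAt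

theorem olverM_zero (a b : ℂ) : olverM a b 0 = (Complex.Gamma b)⁻¹ := by
  rw [olverM_eq_tsum, tsum_eq_single 0]
  · simp [olverCoeff]
  · intro n hn
    simp [hn]

/-- Kummer's equation, as a contiguous relation. -/
theorem olverM_kummer {a b : ℂ} (hb : 0 < b.re) (z : ℂ) :
    olverM a b z = (b - z) * olverM (a + 1) (b + 1) z
      + z * ((a + 1) * olverM (a + 1 + 1) (b + 1 + 1) z) := by
  have hb1 : 0 < (b + 1).re := by simp; positivity
  have hb2 : 0 < (b + 1 + 1).re := by simp; positivity
  have s0 := summable_olverM (a := a) hb z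
  have s1 := summable_olverM (a := a + 1) hb1 z
  have s2 := summable_olverM (a := a + 1 + 1) hb2 z
  have e : (b - z) * olverM (a + 1) (b + 1) z
      + z * ((a + 1) * olverM (a + 1 + 1) (b + 1 + 1) z) =
      b * olverM (a + 1) (b + 1) z + z * (((a + 1) * olverM (a + 1 + 1) (b + 1 + 1) z)
        - olverM (a + 1) (b + 1) z) := by ring
  rw [e]
  simp only [olverM_eq_tsum]
  rw [← tsum_mul_left (a := a + 1), ← (s2.mul_left (a + 1)).tsum_sub s1, ← tsum_mul_left (a := z),
    s0.tsum_eq_zero_add, s1.tsum_eq_zero_add, mul_add, ← tsum_mul_left, add_assoc,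
    ← Summable.tsum_add (((summable_nat_add_iff 1).2 s1).mul_left b)
      (((s2.mul_left (a + 1)).sub s1).mul_left z)]
  congr 1
  · rw [olverCoeff_zero_eq hb]; ring
  · congr 1
    funext n
    have h1 := olverCoeff_eq_sub (a := a) hb n
    have h2 := olverCoeff_succ_mul (a + 1) (b + 1) n
    rw [pow_succ]
    linear_combination (z ^ n * z) * h1 + (z ^ n * z) * h2

/-- Conjugation exchanges (iλ, iy) with (-iλ, -iy) for real b, which reduces λ < 0 to λ > 0 in the
bound on the imaginary axis. -/
theorem olverM_conj (a b z : ℂ) :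
    olverM (starRingEnd ℂ a) (starRingEnd ℂ b) (starRingEnd ℂ z) =
      starRingEnd ℂ (olverM a b z) := by
  rw [olverM_eq_tsum, olverM_eq_tsum, Complex.conj_tsum]
  congr 1
  funext n
  have h : (ascPochhammer ℂ n).eval (starRingEnd ℂ a) =
      starRingEnd ℂ ((ascPochhammer ℂ n).eval a) := by
    induction n with
    | zero => simp
    | succ n ih => simp [ascPochhammer_succ_eval, ih]
  have h2 : Complex.Gamma (starRingEnd ℂ b + n) = starRingEnd ℂ (Complex.Gamma (b + n)) := by
    rw [← Complex.Gamma_conj]; simp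
  simp [olverCoeff, h, h2]

/-- On the imaginary half-axis `i y`, `y ≥ 0`, the function `𝐌(iλ; b; ·)` with `λ > 0` and
`b ≥ 1/2` is bounded by its value at the origin. -/
theorem norm_olverM_le_of_pos {lam b y : ℝ} (hlam : 0 < lam) (hb : 1 / 2 ≤ b) (hy : 0 ≤ y) :
    ‖olverM (Complex.I * lam) b (Complex.I * y)‖ ≤ ‖(Complex.Gamma b)⁻¹‖ := by
  set a : ℂ := Complex.I * lam with ha
  have hb0 : 0 < (b : ℂ).re := by simp; linarith
  have hb1 : 0 < ((b : ℂ) + 1).re := by simp; linarith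
  have hI : ∀ y : ℝ, HasDerivAt (fun y : ℝ => Complex.I * (y : ℂ)) Complex.I y := fun y => by
    simpa using (Complex.ofRealCLM.hasDerivAt (x := y)).const_mul Complex.I
  have hw : ∀ y : ℝ, HasDerivAt (fun y : ℝ => olverM a b (Complex.I * y))
      (a * olverM (a + 1) (b + 1) (Complex.I * y) * Complex.I) y := fun y =>
    (hasDerivAt_olverM hb0 _).comp y (hI y)
  have hv : ∀ y : ℝ, HasDerivAt (fun y : ℝ => olverM (a + 1) (b + 1) (Complex.I * y))
      ((a + 1) * olverM (a + 1 + 1) (b + 1 + 1) (Complex.I * y) * Complex.I) y := fun y =>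
    (hasDerivAt_olverM hb1 _).comp y (hI y)
  -- A Sonin-type energy. With w = 𝐌(a; b; iy) and v = 𝐌(a+1; b+1; iy), one has w' = -λv and, by
  -- Kummer, w = bv - iyv + yv'. The terms in Re(v̄v') cancel and E' = λ(1-2b)|v|², which is
  -- nonpositive exactly because b ≥ 1/2.
  set E : ℝ → ℝ := fun y => ‖olverM a b (Complex.I * y)‖ ^ 2
    + lam * (y * ‖olverM (a + 1) (b + 1) (Complex.I * y)‖ ^ 2) with hE
  have hder : ∀ y : ℝ, HasDerivAt E
      (lam * (1 - 2 * b) * ‖olverM (a + 1) (b + 1) (Complex.I * y)‖ ^ 2) y := by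
    intro y
    have h := (hw y).norm_sq.add (((hasDerivAt_id y).mul (hv y).norm_sq).const_mul lam)
    refine HasDerivAt.congr_deriv h ?_
    clear h
    have hk := olverM_kummer (a := a) hb0 (Complex.I * y)
    generalize olverM a b (Complex.I * y) = w at *
    generalize olverM (a + 1) (b + 1) (Complex.I * y) = v at *
    generalize (a + 1) * olverM (a + 1 + 1) (b + 1 + 1) (Complex.I * y) = u at *
    rw [hk, ha]
    simp only [Complex.inner, Complex.sq_norm, Complex.normSq_apply]
    simp
    ring
  have hanti : AntitoneOn E (Set.Ici 0) := by
    refine antitoneOn_of_deriv_nonpos (convex_Ici 0)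
      (fun y _ => (hder y).continuousAt.continuousWithinAt)
      (fun y _ => (hder y).differentiableAt.differentiableWithinAt) fun y _ => ?_
    rw [(hder y).deriv]
    refine mul_nonpos_of_nonpos_of_nonneg ?_ (by positivity)
    exact mul_nonpos_of_nonneg_of_nonpos hlam.le (by linarith)
  have h1 := hanti (Set.mem_Ici.2 le_rfl) (Set.mem_Ici.2 hy) hy
  have h2 : ‖olverM a b (Complex.I * y)‖ ^ 2 ≤ ‖olverM a b 0‖ ^ 2 := by
    have : 0 ≤ lam * (y * ‖olverM (a + 1) (b + 1) (Complex.I * y)‖ ^ 2) := by positivity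
    simp only [hE] at h1
    simp at h1
    linarith
  rw [olverM_zero] at h2
  exact le_of_sq_le_sq h2 (norm_nonneg _)

theorem norm_olverM_le {lam b y : ℝ} (hlam : lam ≠ 0) (hb : 1 / 2 ≤ b) (hy : 0 ≤ lam * y) :
    ‖olverM (Complex.I * lam) b (Complex.I * y)‖ ≤ ‖(Complex.Gamma b)⁻¹‖ := by
  rcases hlam.lt_or_gt with h | h
  · have hy' : 0 ≤ -y := by nlinarith
    have := norm_olverM_le_of_pos (neg_pos.2 h) hb hy'
    rw [← Complex.norm_conj, ← olverM_conj]
    simpa using this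
  · exact norm_olverM_le_of_pos h hb (nonneg_of_mul_nonneg_right hy h)

end Coulomb

/-! ### Holomorphy of Laplace integrals and the identity theorem on the half-plane. -/

namespace Coulomb

open Set Filter Topology

theorem integrable_exp_neg_mul {α : Type*} [MeasurableSpace α] {μ : Measure α} {ρ : α → ℝ}
    {h : α → ℂ} (hρm : Measurable ρ) (hm : AEStronglyMeasurable h μ)
    (hint : ∀ ε : ℝ, 0 < ε → Integrable (fun x => Real.exp (-(ε * ρ x)) * ‖h x‖) μ) {z : ℂ}
    (hz : 0 < z.re) : Integrable (fun x => Complex.exp (-(z * ρ x)) * h x) μ := by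
  refine (hint z.re hz).mono' ?_ (Eventually.of_forall fun x => ?_)
  · exact (by fun_prop : Measurable fun x => Complex.exp (-(z * ρ x))).aestronglyMeasurable.mul hm
  · rw [norm_mul, Complex.norm_exp]
    simp

/-- A Laplace integral may be differentiated under the integral sign. -/
theorem hasDerivAt_integral_exp_neg_mul {α : Type*} [MeasurableSpace α] {μ : Measure α}
    {ρ : α → ℝ} {h : α → ℂ} (hρ : ∀ᵐ x ∂μ, 0 ≤ ρ x) (hρm : Measurable ρ)
    (hm : AEStronglyMeasurable h μ)
    (hint : ∀ ε : ℝ, 0 < ε → Integrable (fun x => Real.exp (-(ε * ρ x)) * ‖h x‖) μ) {z : ℂ}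
    (hz : 0 < z.re) :
    HasDerivAt (fun z : ℂ => ∫ x, Complex.exp (-(z * ρ x)) * h x ∂μ)
      (∫ x, -(ρ x * (Complex.exp (-(z * ρ x)) * h x)) ∂μ) z := by
  have hmeas : ∀ w : ℂ, AEStronglyMeasurable (fun x => Complex.exp (-(w * ρ x)) * h x) μ :=
    fun w => (by fun_prop : Measurable fun x => Complex.exp (-(w * ρ x))).aestronglyMeasurable.mul hm
  have hball : Metric.ball z (z.re / 2) ∈ 𝓝 z := Metric.ball_mem_nhds z (by positivity)
  refine (hasDerivAt_integral_of_dominated_loc_of_deriv_le (𝕜 := ℂ)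
    (F' := fun w x => -(ρ x * (Complex.exp (-(w * ρ x)) * h x)))
    -- On the ball Re w ≥ Re z / 2. Half of that decay absorbs the factor ρ through t ≤ e^t with t =
    -- (Re z / 4)ρ, and the other half remains.
    (bound := fun x => 4 / z.re * (Real.exp (-(z.re / 4 * ρ x)) * ‖h x‖))
    hball (Eventually.of_forall hmeas) (integrable_exp_neg_mul hρm hm hint hz) ?_ ?_
    ((hint _ (by positivity)).const_mul _) ?_).2
  · exact ((by fun_prop : Measurable fun x => (ρ x : ℂ)).aestronglyMeasurable.mul (hmeas z)).neg
  · filter_upwards [hρ] with x hx w hw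
    have hw' : z.re / 2 ≤ w.re := by
      have h1 := (Complex.abs_re_le_norm (w - z)).trans (mem_ball_iff_norm.1 hw).le
      rw [Complex.sub_re] at h1
      linarith [neg_abs_le (w.re - z.re)]
    rw [norm_neg, norm_mul, norm_mul, Complex.norm_exp, Complex.norm_real, Real.norm_of_nonneg hx,
      ← mul_assoc, ← mul_assoc]
    refine mul_le_mul_of_nonneg_right ?_ (norm_nonneg _)
    have h2 : (-(w * (ρ x : ℂ))).re = -(w.re * ρ x) := by simp
    rw [h2]
    have h3 : z.re / 4 * ρ x ≤ Real.exp (z.re / 4 * ρ x) := by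
      linarith [Real.add_one_le_exp (z.re / 4 * ρ x)]
    have h4 : ρ x ≤ 4 / z.re * Real.exp (z.re / 4 * ρ x) := by
      rw [div_mul_eq_mul_div, le_div_iff₀ hz]
      linarith
    calc ρ x * Real.exp (-(w.re * ρ x))
        ≤ (4 / z.re * Real.exp (z.re / 4 * ρ x)) * Real.exp (-(z.re / 2 * ρ x)) := by
          gcongr
      _ = _ := by
          rw [mul_assoc, ← Real.exp_add]
          congr 2
          ring
  · refine Eventually.of_forall fun x w _ => ?_
    have h1 : HasDerivAt (fun w : ℂ => -(w * (ρ x : ℂ))) (-(1 * (ρ x : ℂ))) w :=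
      ((hasDerivAt_id w).mul_const _).neg
    refine (h1.cexp.mul_const (h x)).congr_deriv ?_
    ring

theorem isOpen_re_pos : IsOpen {z : ℂ | 0 < z.re} := isOpen_lt continuous_const Complex.continuous_re

theorem differentiableOn_integral_exp_neg_mul {α : Type*} [MeasurableSpace α] {μ : Measure α}
    {ρ : α → ℝ} {h : α → ℂ} (hρ : ∀ᵐ x ∂μ, 0 ≤ ρ x) (hρm : Measurable ρ)
    (hm : AEStronglyMeasurable h μ)
    (hint : ∀ ε : ℝ, 0 < ε → Integrable (fun x => Real.exp (-(ε * ρ x)) * ‖h x‖) μ) :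
    DifferentiableOn ℂ (fun z : ℂ => ∫ x, Complex.exp (-(z * ρ x)) * h x ∂μ) {z | 0 < z.re} :=
  fun _ hz => (hasDerivAt_integral_exp_neg_mul hρ hρm hm hint
    hz).differentiableAt.differentiableWithinAt

/-- Holomorphic functions on the right half-plane that agree at large real numbers are equal. -/
theorem eq_of_eq_large_real {f g : ℂ → ℂ} (hf : DifferentiableOn ℂ f {z | 0 < z.re})
    (hg : DifferentiableOn ℂ g {z | 0 < z.re}) {R : ℝ} (h : ∀ x : ℝ, R < x → f x = g x) {z : ℂ}
    (hz : 0 < z.re) : f z = g z := by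
  set x₀ : ℝ := max R 0 + 1 with hx₀
  have h0 : 0 < x₀ := by positivity
  have hR : R < x₀ := by linarith [le_max_left R 0]
  have hfr : ∃ᶠ w in 𝓝[≠] (x₀ : ℂ), f w = g w := by
    have ht : Tendsto (fun x : ℝ => (x : ℂ)) (𝓝[≠] x₀) (𝓝[≠] (x₀ : ℂ)) :=
      Complex.continuous_ofReal.continuousAt.tendsto.inf (tendsto_principal_principal.2
        fun x hx => by simpa using hx)
    refine ht.frequently (Eventually.frequently ?_)
    exact (eventually_nhdsWithin_of_eventually_nhds (eventually_gt_nhds hR)).mono h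
  exact (hf.analyticOnNhd isOpen_re_pos).eqOn_of_preconnected_of_frequently_eq
    (hg.analyticOnNhd isOpen_re_pos) (convex_halfSpace_re_gt 0).isPreconnected
    (by simpa using h0) hfr hz

theorem integrableOn_rpow_mul_exp_neg {b ε : ℝ} (hb : 0 < b) (hε : 0 < ε) :
    IntegrableOn (fun t : ℝ => t ^ (b - 1) * Real.exp (-(ε * t))) (Ioi 0) := by
  simpa using integrableOn_rpow_mul_exp_neg_mul_rpow (p := 1) (s := b - 1) (b := ε) (by linarith)
    one_pos hε

/-- Euler's integral for the Gamma function with a complex rate. -/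
theorem integral_cpow_mul_exp_neg_mul {b : ℝ} {z : ℂ} (hb : 0 < b) (hz : 0 < z.re) :
    ∫ t : ℝ in Ioi 0, Complex.exp (-(z * t)) * ((t ^ (b - 1) : ℝ) : ℂ) =
      z ^ (-b : ℂ) * Complex.Gamma b := by
  refine eq_of_eq_large_real (f := fun z : ℂ => ∫ t : ℝ in Ioi 0,
    Complex.exp (-(z * t)) * ((t ^ (b - 1) : ℝ) : ℂ)) (g := fun z => z ^ (-b : ℂ) * Complex.Gamma b)
    (R := 0) ?_ ?_ ?_ hz
  · refine differentiableOn_integral_exp_neg_mul ?_ measurable_id ?_ ?_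
    · filter_upwards [ae_restrict_mem measurableSet_Ioi] with t ht using le_of_lt ht
    · exact (by fun_prop : Measurable fun t : ℝ => ((t ^ (b - 1) : ℝ) : ℂ)).aestronglyMeasurable
    · intro ε hε
      refine (integrableOn_rpow_mul_exp_neg hb hε).congr_fun (fun t ht => ?_) measurableSet_Ioi
      have ht' : (0 : ℝ) < t := ht
      simp only [Complex.norm_real, Real.norm_eq_abs, abs_of_pos (Real.rpow_pos_of_pos ht' _)]
      ring
  · intro w hw
    have hw' : w ∈ Complex.slitPlane := Or.inl hw
    exact ((differentiableAt_id.cpow (differentiableAt_const _) hw').mul_const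
      _).differentiableWithinAt
  · intro x hx
    have hG := Complex.integral_cpow_mul_exp_neg_mul_Ioi (a := (b : ℂ)) (r := x) (by simpa) hx
    have e : ((x : ℂ)) ^ (-b : ℂ) = (1 / (x : ℂ)) ^ (b : ℂ) := by
      rw [Complex.cpow_neg, one_div, Complex.inv_cpow]
      rw [Complex.arg_ofReal_of_nonneg hx.le]
      exact Real.pi_pos.ne
    simp only [e, ← hG]
    refine setIntegral_congr_fun measurableSet_Ioi fun t ht => ?_
    have ht' : (0 : ℝ) ≤ t := le_of_lt ht
    rw [Complex.ofReal_cpow ht']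
    push_cast
    ring

/-! ### The Cauchy-Schlömilch substitution and subordination to Gaussians. -/

section CauchySchlomilch

theorem image_mul_sub_div {p q : ℝ} (hp : 0 < p) (hq : 0 < q) :
    (fun s : ℝ => p * s - q / s) '' Ioi 0 = univ := by
  refine eq_univ_of_forall fun x => ?_
  have h0 : 0 < x ^ 2 + 4 * p * q := by positivity
  have h1 : |x| < √(x ^ 2 + 4 * p * q) := by
    rw [← Real.sqrt_sq_eq_abs]
    exact Real.sqrt_lt_sqrt (sq_nonneg x) (by linarith [mul_pos hp hq])
  have h2 : 0 < x + √(x ^ 2 + 4 * p * q) := by linarith [neg_abs_le x]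
  -- The positive root of ps² - xs - q = 0.
  refine ⟨(x + √(x ^ 2 + 4 * p * q)) / (2 * p), by simp only [mem_Ioi]; positivity, ?_⟩
  have h3 := Real.sq_sqrt h0.le
  generalize √(x ^ 2 + 4 * p * q) = S at *
  have h4 : q / ((x + S) / (2 * p)) = (S - x) / 2 := by
    rw [div_eq_iff (by positivity)]
    field_simp
    linear_combination -h3
  have h5 : p * ((x + S) / (2 * p)) = (x + S) / 2 := by field_simp
  simp only [h4, h5]
  ring

theorem injOn_mul_sub_div {p q : ℝ} (hp : 0 < p) (hq : 0 < q) :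
    InjOn (fun s : ℝ => p * s - q / s) (Ioi 0) := by
  refine StrictMonoOn.injOn fun s hs t _ hst => ?_
  have hs' : (0 : ℝ) < s := hs
  have h1 : q / t < q / s := div_lt_div_of_pos_left hq hs' hst
  have h2 : p * s < p * t := by gcongr
  linarith

/-- The Cauchy-Schlömilch substitution applied to the Gaussian integral. -/
theorem integral_exp_neg_sq_mul_sub_div {p q : ℝ} (hp : 0 < p) (hq : 0 < q) :
    IntegrableOn (fun s : ℝ => Real.exp (-(p * s - q / s) ^ 2)) (Ioi 0) ∧
      ∫ s in Ioi 0, Real.exp (-(p * s - q / s) ^ 2) = √π / (2 * p) := by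
  set G : ℝ → ℝ := fun s => Real.exp (-(p * s - q / s) ^ 2) with hG
  have hd : ∀ s ∈ Ioi (0 : ℝ), HasDerivWithinAt (fun s : ℝ => p * s - q / s) (p + q / s ^ 2)
      (Ioi 0) s := by
    intro s hs
    have hs' : s ≠ 0 := (mem_Ioi.1 hs).ne'
    have h := ((hasDerivAt_id s).const_mul p).sub ((hasDerivAt_inv hs').const_mul q)
    refine (HasDerivAt.congr_deriv (f := fun s : ℝ => p * s - q / s) h ?_).hasDerivWithinAt
    simp [div_eq_mul_inv]
  have hgauss : Integrable fun x : ℝ => Real.exp (-x ^ 2) := by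
    simpa using integrable_exp_neg_mul_sq one_pos
  have habs : ∀ s ∈ Ioi (0 : ℝ), |p + q / s ^ 2| • Real.exp (-(p * s - q / s) ^ 2) =
      p * G s + q / s ^ 2 * G s := by
    intro s hs
    have hs' : (0 : ℝ) < s := hs
    rw [abs_of_pos (by positivity), smul_eq_mul, add_mul]
  have hI : IntegrableOn (fun s => p * G s + q / s ^ 2 * G s) (Ioi 0) := by
    have h := (integrableOn_image_iff_integrableOn_abs_deriv_smul measurableSet_Ioi hd
      (injOn_mul_sub_div hp hq) (fun x : ℝ => Real.exp (-x ^ 2))).1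
      (by rw [image_mul_sub_div hp hq]; exact hgauss.integrableOn)
    exact h.congr_fun habs measurableSet_Ioi
  have hmeas : AEStronglyMeasurable G (volume.restrict (Ioi 0)) :=
    (by fun_prop : Measurable G).aestronglyMeasurable
  have hI1 : IntegrableOn G (Ioi 0) := by
    refine (hI.const_mul p⁻¹).mono' hmeas ?_
    filter_upwards [ae_restrict_mem measurableSet_Ioi] with s hs
    have hs' : (0 : ℝ) < s := hs
    have hG0 : 0 < G s := Real.exp_pos _
    rw [Real.norm_of_nonneg hG0.le, mul_add, inv_mul_cancel_left₀ hp.ne']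
    have : 0 < p⁻¹ * (q / s ^ 2 * G s) := by positivity
    linarith
  have hI2 : IntegrableOn (fun s => q / s ^ 2 * G s) (Ioi 0) := by
    refine (hI.sub (hI1.const_mul p)).congr_fun (fun s _ => ?_) measurableSet_Ioi
    simp
  have hsum : ∫ s in Ioi 0, (p * G s + q / s ^ 2 * G s) = √π := by
    have h := integral_image_eq_integral_abs_deriv_smul measurableSet_Ioi hd
      (injOn_mul_sub_div hp hq) (fun x : ℝ => Real.exp (-x ^ 2))
    rw [image_mul_sub_div hp hq, Measure.restrict_univ] at h
    rw [setIntegral_congr_fun measurableSet_Ioi habs] at h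
    rw [← h]
    simpa using integral_gaussian 1
  -- The involution s ↦ q/(ps) preserves (ps - q/s)², so the two parts of the Gaussian integral ∫ (p
  -- + q/s²) G = √π are equal. It is carried out as a dilation by q/p followed by s ↦ 1/s.
  have hsymm : ∫ s in Ioi 0, q / s ^ 2 * G s = p * ∫ s in Ioi 0, G s := by
    have h1 := integral_comp_mul_left_Ioi (fun s => q / s ^ 2 * G s) 0 (div_pos hq hp)
    rw [mul_zero] at h1
    have h2 := integral_comp_rpow_Ioi G (p := -1) (by norm_num)
    have h3 : ∫ s in Ioi 0, q / (q / p * s) ^ 2 * G (q / p * s) =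
        p ^ 2 / q * ∫ s in Ioi 0, G s := by
      rw [← h2, ← integral_const_mul]
      refine setIntegral_congr_fun measurableSet_Ioi fun s hs => ?_
      have hs' : (0 : ℝ) < s := hs
      have e1 : G (q / p * s) = G (s ^ (-1 : ℝ)) := by
        simp only [hG, Real.rpow_neg_one]
        congr 1
        field_simp
        ring
      have e2 : s ^ ((-1 : ℝ) - 1) = (s ^ 2)⁻¹ := by
        rw [show (-1 : ℝ) - 1 = -2 by norm_num, Real.rpow_neg hs'.le]
        simp
      simp only [e1, e2, smul_eq_mul, abs_neg, abs_one, one_mul]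
      field_simp
    rw [h3, smul_eq_mul] at h1
    have h4 : (q / p)⁻¹ * (∫ s in Ioi 0, q / s ^ 2 * G s) = p ^ 2 / q * ∫ s in Ioi 0, G s := h1.symm
    rw [inv_div, div_mul_eq_mul_div, div_eq_iff hq.ne'] at h4
    apply mul_left_cancel₀ hp.ne'
    rw [h4]
    field_simp
  refine ⟨hI1, ?_⟩
  rw [integral_add (hI1.const_mul p) hI2, hsymm, integral_const_mul] at hsum
  rw [eq_div_iff (by positivity)]
  linarith

/-- The subordination formula expressing `e^{-μ r} / r` through Gaussians in `r`. -/
theorem integral_rpow_mul_exp_neg_sub_div {m r : ℝ} (hm : 0 < m) (hr : 0 < r) :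
    ∫ t in Ioi 0, t ^ (-(3 / 2) : ℝ) * Real.exp (-(m ^ 2 * t) - r ^ 2 / (4 * t)) =
      2 * √π * (Real.exp (-(m * r)) / r) := by
  -- With t = s⁻² the Jacobian 2s⁻³ cancels t^{-3/2} = s³ up to the factor 2, and the exponent
  -- completes to -mr - (rs/2 - m/s)².
  have h1 := integral_comp_rpow_Ioi (fun t : ℝ => t ^ (-(3 / 2) : ℝ) *
    Real.exp (-(m ^ 2 * t) - r ^ 2 / (4 * t))) (p := -2) (by norm_num)
  rw [← h1]
  have h2 := (integral_exp_neg_sq_mul_sub_div (p := r / 2) (q := m) (by positivity) hm).2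
  have h3 : ∫ s in Ioi (0 : ℝ), (|(-2 : ℝ)| * s ^ ((-2 : ℝ) - 1)) • ((s ^ (-2 : ℝ)) ^ (-(3 / 2) : ℝ) *
      Real.exp (-(m ^ 2 * s ^ (-2 : ℝ)) - r ^ 2 / (4 * s ^ (-2 : ℝ)))) =
      ∫ s in Ioi (0 : ℝ), 2 * Real.exp (-(m * r)) * Real.exp (-(r / 2 * s - m / s) ^ 2) := by
    refine setIntegral_congr_fun measurableSet_Ioi fun s hs => ?_
    have hs' : (0 : ℝ) < s := hs
    have e1 : (s ^ (-2 : ℝ)) ^ (-(3 / 2) : ℝ) = s ^ 3 := by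
      rw [← Real.rpow_mul hs'.le, ← Real.rpow_natCast]
      norm_num
    have e2 : s ^ ((-2 : ℝ) - 1) = (s ^ 3)⁻¹ := by
      rw [show (-2 : ℝ) - 1 = -((3 : ℕ) : ℝ) by norm_num, Real.rpow_neg hs'.le, Real.rpow_natCast]
    have e3 : s ^ (-2 : ℝ) = (s ^ 2)⁻¹ := by
      rw [show (-2 : ℝ) = -((2 : ℕ) : ℝ) by norm_num, Real.rpow_neg hs'.le, Real.rpow_natCast]
    rw [e1, e2, e3, smul_eq_mul, mul_assoc (2 : ℝ), ← Real.exp_add]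
    have e4 : -(m ^ 2 * (s ^ 2)⁻¹) - r ^ 2 / (4 * (s ^ 2)⁻¹) =
        -(m * r) + -(r / 2 * s - m / s) ^ 2 := by
      field_simp
      ring
    rw [e4, abs_neg, abs_two]
    field_simp
  rw [h3, integral_const_mul, h2]
  field_simp

end CauchySchlomilch

end Coulomb

/-! ### The transform of e^{-m|x|}/|x| at complex frequencies. -/

namespace Coulomb

open Set Filter Topology

/-- The complex-linear form `x ↦ ⟨v, x⟩ + i ⟨w, x⟩`. -/
noncomputable def linForm {d : ℕ} (v w x : Space d) : ℂ :=
  ((inner ℝ v x : ℝ) : ℂ) + Complex.I * ((inner ℝ w x : ℝ) : ℂ)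

/-- The complex square `(v + i w) · (v + i w)`. -/
noncomputable def complexSq {d : ℕ} (v w : Space d) : ℂ :=
  ((‖v‖ ^ 2 - ‖w‖ ^ 2 : ℝ) : ℂ) + 2 * Complex.I * ((inner ℝ v w : ℝ) : ℂ)

theorem measurable_linForm {d : ℕ} (v w : Space d) : Measurable (linForm v w) := by
  unfold linForm
  fun_prop

theorem linForm_re {d : ℕ} (v w x : Space d) : (linForm v w x).re = inner ℝ v x := by
  simp [linForm]

theorem complexSq_re {d : ℕ} (v w : Space d) : (complexSq v w).re = ‖v‖ ^ 2 - ‖w‖ ^ 2 := by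
  rw [complexSq, Complex.add_re, Complex.ofReal_re, Complex.re_mul_ofReal]
  simp

theorem gaussian_toLp_eq {d : ℕ} (β : ℝ) (v w : Space d) (x : Fin d → ℝ) :
    Complex.exp (-(β : ℂ) * ((‖WithLp.toLp 2 x‖ ^ 2 : ℝ) : ℂ) + linForm v w (WithLp.toLp 2 x)) =
      Complex.exp (-(β : ℂ) * ∑ i, ((x i : ℝ) : ℂ) ^ 2 +
        ∑ i, (((v i : ℝ) : ℂ) + Complex.I * ((w i : ℝ) : ℂ)) * x i) := by
  congr 2
  · rw [EuclideanSpace.real_norm_sq_eq]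
    push_cast
    rfl
  · simp only [linForm, PiLp.inner_apply, RCLike.inner_apply, conj_trivial, Complex.ofReal_sum,
      Complex.ofReal_mul, Finset.mul_sum, ← Finset.sum_add_distrib]
    refine Finset.sum_congr rfl fun i _ => ?_
    ring

theorem integral_gaussian_linForm {d : ℕ} {β : ℝ} (hβ : 0 < β) (v w : Space d) :
    ∫ x : Space d, Complex.exp (-(β : ℂ) * ((‖x‖ ^ 2 : ℝ) : ℂ) + linForm v w x) =
      (((π / β) ^ ((d : ℝ) / 2) : ℝ) : ℂ) * Complex.exp (complexSq v w / (4 * β)) := by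
  rw [← (PiLp.volume_preserving_toLp (Fin d)).integral_comp
    (MeasurableEquiv.toLp 2 _).measurableEmbedding]
  have h := GaussianFourier.integral_cexp_neg_mul_sum_add (b := (β : ℂ)) (by simpa)
    (fun i => ((v i : ℝ) : ℂ) + Complex.I * ((w i : ℝ) : ℂ))
  simp_rw [gaussian_toLp_eq]
  rw [h]
  congr 1
  · rw [Complex.ofReal_cpow (by positivity)]
    simp
  · congr 2
    rw [complexSq, EuclideanSpace.real_norm_sq_eq, EuclideanSpace.real_norm_sq_eq]
    simp only [PiLp.inner_apply, RCLike.inner_apply, conj_trivial, Complex.ofReal_sum,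
      Complex.ofReal_sub, Complex.ofReal_mul, Complex.ofReal_pow, Finset.mul_sum,
      ← Finset.sum_sub_distrib, ← Finset.sum_add_distrib]
    refine Finset.sum_congr rfl fun i _ => ?_
    linear_combination ((w i : ℝ) : ℂ) ^ 2 * Complex.I_sq

/-- The Gaussian contributes t^{d/2}, which turns the subordination weight t^{-3/2} into t^{b-1}
with b = (d-1)/2: the remaining t-integral is an Euler integral for Γ(b). -/
theorem integral_heat_linForm {d : ℕ} {t : ℝ} (ht : 0 < t) (m : ℝ) (v w : Space d) :
    ∫ x : Space d, ((t ^ (-(3 / 2) : ℝ) * Real.exp (-(m ^ 2 * t) - ‖x‖ ^ 2 / (4 * t)) : ℝ) : ℂ)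
        * Complex.exp (linForm v w x) =
      (((4 * π) ^ ((d : ℝ) / 2) : ℝ) : ℂ) * (Complex.exp (-((m ^ 2 - complexSq v w) * t))
        * ((t ^ (((d : ℝ) - 1) / 2 - 1) : ℝ) : ℂ)) := by
  have h := integral_gaussian_linForm (β := 1 / (4 * t)) (by positivity) v w
  have e1 : ∀ x : Space d,
      ((t ^ (-(3 / 2) : ℝ) * Real.exp (-(m ^ 2 * t) - ‖x‖ ^ 2 / (4 * t)) : ℝ) : ℂ)
        * Complex.exp (linForm v w x) =
      ((t ^ (-(3 / 2) : ℝ) * Real.exp (-(m ^ 2 * t)) : ℝ) : ℂ) *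
        Complex.exp (-((1 / (4 * t) : ℝ) : ℂ) * ((‖x‖ ^ 2 : ℝ) : ℂ) + linForm v w x) := by
    intro x
    rw [Complex.exp_add, sub_eq_add_neg, Real.exp_add]
    push_cast
    have : -((‖x‖ : ℂ) ^ 2 / (4 * (t : ℂ))) = -(1 / (4 * (t : ℂ))) * (‖x‖ : ℂ) ^ 2 := by ring
    rw [this]
    ring
  simp_rw [e1]
  rw [integral_const_mul, h]
  have e2 : π / (1 / (4 * t)) = 4 * π * t := by field_simp
  have e3 : t ^ (((d : ℝ) - 1) / 2 - 1) = t ^ (-(3 / 2) : ℝ) * t ^ ((d : ℝ) / 2) := by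
    rw [← Real.rpow_add ht]
    congr 1
    ring
  have e4 : complexSq v w / (4 * ((1 / (4 * t) : ℝ) : ℂ)) = complexSq v w * t := by
    have : (t : ℂ) ≠ 0 := by exact_mod_cast ht.ne'
    push_cast
    field_simp
  have e5 : Complex.exp (-((m ^ 2 - complexSq v w) * t)) =
      Complex.exp (-(m ^ 2 * t)) * Complex.exp (complexSq v w * t) := by
    rw [← Complex.exp_add]
    congr 1
    ring
  rw [e2, e3, e4, e5, Real.mul_rpow (by positivity) ht.le]
  push_cast
  ring

/-- The licence for Fubini. In absolute value the oscillating vector w drops out, and the x-integral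
is the explicit one with w = 0; it is integrable in t at infinity since ‖v‖ < m, and at 0 since d ≥
2. -/
theorem integrable_heat_linForm {d : ℕ} (hd : 2 ≤ d) {m : ℝ} {v : Space d} (hv : ‖v‖ < m)
    (w : Space d) :
    Integrable (fun p : Space d × ℝ =>
      ((p.2 ^ (-(3 / 2) : ℝ) * Real.exp (-(m ^ 2 * p.2) - ‖p.1‖ ^ 2 / (4 * p.2)) : ℝ) : ℂ)
        * Complex.exp (linForm v w p.1)) (volume.prod (volume.restrict (Ioi 0))) := by
  have hlin : Measurable fun p : Space d × ℝ => linForm v w p.1 :=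
    (measurable_linForm v w).comp measurable_fst
  have hd' : (2 : ℝ) ≤ d := by exact_mod_cast hd
  rw [integrable_prod_iff' (by
    refine Measurable.aestronglyMeasurable ?_
    fun_prop)]
  constructor
  · filter_upwards [ae_restrict_mem measurableSet_Ioi] with t ht
    have ht' : (0 : ℝ) < t := ht
    -- A non-integrable function has integral 0 by convention, whereas the closed formula is
    -- nonzero; so integrability follows from the value.
    by_contra hcon
    have h := integral_heat_linForm ht' m v w
    rw [integral_undef hcon] at h
    have h1 : (4 * π) ^ ((d : ℝ) / 2) ≠ 0 := by positivity
    have h2 : t ^ (((d : ℝ) - 1) / 2 - 1) ≠ 0 := by positivity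
    exact mul_ne_zero (Complex.ofReal_ne_zero.2 h1) (mul_ne_zero (Complex.exp_ne_zero _)
      (Complex.ofReal_ne_zero.2 h2)) h.symm
  · have hpos : 0 < m ^ 2 - ‖v‖ ^ 2 := by nlinarith [norm_nonneg v]
    refine IntegrableOn.congr_fun (f := fun t : ℝ => (4 * π) ^ ((d : ℝ) / 2) *
      (t ^ (((d : ℝ) - 1) / 2 - 1) * Real.exp (-((m ^ 2 - ‖v‖ ^ 2) * t))))
      ((integrableOn_rpow_mul_exp_neg (by linarith) hpos).const_mul _) (fun t ht => ?_)
      measurableSet_Ioi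
    have ht' : (0 : ℝ) < t := ht
    apply Complex.ofReal_injective
    simp only
    rw [← integral_complex_ofReal]
    have h := integral_heat_linForm ht' m v (0 : Space d)
    have e : ∀ x : Space d, ((‖((t ^ (-(3 / 2) : ℝ) * Real.exp (-(m ^ 2 * t) - ‖x‖ ^ 2 / (4 * t))
        : ℝ) : ℂ) * Complex.exp (linForm v w x)‖ : ℝ) : ℂ) =
        ((t ^ (-(3 / 2) : ℝ) * Real.exp (-(m ^ 2 * t) - ‖x‖ ^ 2 / (4 * t)) : ℝ) : ℂ)
        * Complex.exp (linForm v 0 x) := by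
      intro x
      rw [norm_mul, Complex.norm_exp, linForm_re, Complex.norm_real,
        Real.norm_of_nonneg (by positivity)]
      simp [linForm]
    simp_rw [e]
    rw [h]
    simp only [complexSq, norm_zero, inner_zero_right]
    push_cast
    ring_nf

/-- The Laplace-Fourier transform of `e^{-m|x|} / |x|` at a complex frequency. -/
theorem integral_exp_neg_norm_div_norm {d : ℕ} (hd : 2 ≤ d) {m : ℝ} {v : Space d} (hv : ‖v‖ < m)
    (w : Space d) :
    ∫ x : Space d, ((Real.exp (-(m * ‖x‖)) / ‖x‖ : ℝ) : ℂ) * Complex.exp (linForm v w x) =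
      (((4 * π) ^ ((d : ℝ) / 2) / (2 * √π) : ℝ) : ℂ) *
        (((m : ℂ) ^ 2 - complexSq v w) ^ (-(((d : ℝ) - 1) / 2 : ℝ) : ℂ)
          * Complex.Gamma (((d : ℝ) - 1) / 2 : ℝ)) := by
  have hm : 0 < m := (norm_nonneg v).trans_lt hv
  have hd' : (2 : ℝ) ≤ d := by exact_mod_cast hd
  have : NeZero d := ⟨by omega⟩
  have hne : ∀ᵐ x : Space d, x ≠ 0 := by
    simp [ae_iff, measure_singleton]
  have h1 : ∀ᵐ x : Space d, ((Real.exp (-(m * ‖x‖)) / ‖x‖ : ℝ) : ℂ) * Complex.exp (linForm v w x) =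
      ((1 / (2 * √π) : ℝ) : ℂ) * ∫ t in Ioi 0,
        ((t ^ (-(3 / 2) : ℝ) * Real.exp (-(m ^ 2 * t) - ‖x‖ ^ 2 / (4 * t)) : ℝ) : ℂ)
        * Complex.exp (linForm v w x) := by
    filter_upwards [hne] with x hx
    rw [integral_mul_const, integral_complex_ofReal,
      integral_rpow_mul_exp_neg_sub_div hm (norm_pos_iff.2 hx), ← mul_assoc, ← Complex.ofReal_mul]
    congr 2
    field_simp
  rw [integral_congr_ae h1, integral_const_mul,
    integral_integral_swap (integrable_heat_linForm hd hv w)]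
  have h2 : ∫ t in Ioi (0 : ℝ), ∫ x : Space d,
      ((t ^ (-(3 / 2) : ℝ) * Real.exp (-(m ^ 2 * t) - ‖x‖ ^ 2 / (4 * t)) : ℝ) : ℂ)
        * Complex.exp (linForm v w x) =
      ∫ t in Ioi (0 : ℝ), (((4 * π) ^ ((d : ℝ) / 2) : ℝ) : ℂ) *
        (Complex.exp (-((m ^ 2 - complexSq v w) * t))
        * ((t ^ (((d : ℝ) - 1) / 2 - 1) : ℝ) : ℂ)) :=
    setIntegral_congr_fun measurableSet_Ioi fun t ht => integral_heat_linForm ht m v w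
  rw [h2, integral_const_mul, integral_cpow_mul_exp_neg_mul (by linarith)]
  · push_cast
    ring
  · rw [Complex.sub_re, complexSq_re]
    norm_cast
    nlinarith [norm_nonneg v, sq_nonneg ‖w‖]

/-- Radial integrability of `e^{-ε|x|} / |x|` in dimension at least two. -/
theorem integrable_exp_neg_norm_div_norm {d : ℕ} (hd : 2 ≤ d) {ε : ℝ} (hε : 0 < ε) :
    Integrable fun x : Space d => Real.exp (-(ε * ‖x‖)) * ‖x‖⁻¹ := by
  -- The same device: the closed formula at frequency zero is nonzero, so the integral cannot be the
  -- default value 0.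
  by_contra hcon
  have h := integral_exp_neg_norm_div_norm hd (m := ε) (v := (0 : Space d)) (by simpa) 0
  have hd' : (2 : ℝ) ≤ d := by exact_mod_cast hd
  have e : (fun x : Space d => ((Real.exp (-(ε * ‖x‖)) / ‖x‖ : ℝ) : ℂ) *
      Complex.exp (linForm (0 : Space d) 0 x)) =
      fun x : Space d => ((Real.exp (-(ε * ‖x‖)) * ‖x‖⁻¹ : ℝ) : ℂ) := by
    funext x
    simp [linForm, div_eq_mul_inv]
  rw [e, integral_complex_ofReal, integral_undef hcon] at h
  have h1 : (4 * π) ^ ((d : ℝ) / 2) / (2 * √π) ≠ 0 := by positivity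
  have h2 : Complex.Gamma (((d : ℝ) - 1) / 2 : ℝ) ≠ 0 :=
    Complex.Gamma_ne_zero_of_re_pos (by rw [Complex.ofReal_re]; linarith)
  refine mul_ne_zero (Complex.ofReal_ne_zero.2 h1) (mul_ne_zero ?_ h2) h.symm
  rw [Complex.cpow_ne_zero_iff]
  left
  have : (ε : ℂ) ≠ 0 := by exact_mod_cast hε.ne'
  simpa [complexSq] using this

end Coulomb

/-! ### Moments of the parabolic coordinate via their generating function. -/

namespace Coulomb

open Set Filter Topology

/-- The binomial series `(1 - x)^{-a} = ∑ (a)ₙ xⁿ / n!`. -/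
theorem hasSum_one_sub_cpow_neg (a : ℂ) {x : ℂ} (hx : ‖x‖ < 1) :
    HasSum (fun n : ℕ => (ascPochhammer ℂ n).eval a / (n.factorial : ℂ) * x ^ n)
      ((1 - x) ^ (-a)) := by
  have h := (Complex.one_div_one_sub_cpow_hasFPowerSeriesOnBall_zero a).hasSum (y := x)
    (by
      rw [Metric.mem_eball, edist_zero_right, ← ofReal_norm, ← ENNReal.ofReal_one]
      exact (ENNReal.ofReal_lt_ofReal_iff one_pos).2 hx)
  rw [zero_add, one_div, ← Complex.cpow_neg] at h
  convert! h using 2 with n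
  have hn : (n.factorial : ℂ) ≠ 0 := by exact_mod_cast n.factorial_ne_zero
  have e := Ring.factorial_nsmul_multichoose_eq_ascPochhammer a n
  rw [Polynomial.ascPochhammer_smeval_eq_eval, nsmul_eq_mul] at e
  have e2 : Ring.choose (a + n - 1) n = Ring.multichoose a n := by
    rw [Ring.choose]
    congr 1
    ring
  rw [FormalMultilinearSeries.ofScalars_apply_eq, e2, ← e, smul_eq_mul]
  field_simp

/-- Uniqueness of power series at 0, used to read the moments off their generating function. -/
theorem eq_of_hasSum_pow_smul {c c' : ℕ → ℂ} {f : ℝ → ℂ}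
    (h : ∀ᶠ t : ℝ in 𝓝 0, HasSum (fun n => t ^ n • c n) (f t))
    (h' : ∀ᶠ t : ℝ in 𝓝 0, HasSum (fun n => t ^ n • c' n) (f t)) : c = c' := by
  set p : (ℕ → ℂ) → FormalMultilinearSeries ℝ ℝ ℂ :=
    fun c n => ContinuousMultilinearMap.mkPiRing ℝ (Fin n) (c n) with hp
  have hcoeff : ∀ c n, (p c).coeff n = c n := by
    intro c n
    simp [hp, FormalMultilinearSeries.coeff]
  have key : ∀ c : ℕ → ℂ, (∀ᶠ t : ℝ in 𝓝 0, HasSum (fun n => t ^ n • c n) (f t)) →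
      HasFPowerSeriesAt f (p c) 0 := by
    intro c hc
    rw [hasFPowerSeriesAt_iff]
    filter_upwards [hc] with t ht
    simpa only [hcoeff, zero_add] using ht
  have h1 := (key c h).eq_formalMultilinearSeries (key c' h')
  funext n
  rw [← hcoeff c, h1, hcoeff]

/-- A positive factor leaves the argument unchanged, so the principal branch needs no correction. -/
theorem ofReal_mul_cpow {r : ℝ} (hr : 0 < r) {x : ℂ} (hx : x ≠ 0) (s : ℂ) :
    ((r : ℂ) * x) ^ s = (r : ℂ) ^ s * x ^ s := by
  have hr' : (r : ℂ) ≠ 0 := by exact_mod_cast hr.ne'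
  rw [Complex.cpow_def_of_ne_zero (mul_ne_zero hr' hx), Complex.cpow_def_of_ne_zero hr',
    Complex.cpow_def_of_ne_zero hx, Complex.log_ofReal_mul hr hx, Complex.ofReal_log hr.le, add_mul,
    Complex.exp_add]

/-- Term-by-term integration of an exponential-type power series in a function of linear growth
against an exponentially decaying kernel. -/
theorem hasSum_integral_mul_pow {d : ℕ} (hd : 2 ≤ d) {ε M C ρ : ℝ} {K : Space d → ℂ}
    (hKm : AEStronglyMeasurable K) (hK : ∀ x, ‖K x‖ ≤ Real.exp (-(ε * ‖x‖)) * ‖x‖⁻¹)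
    {y : Space d → ℝ} (hym : Measurable y) (hy : ∀ x, |y x| ≤ M * ‖x‖) {c : ℕ → ℂ} (hC : 0 ≤ C)
    (hρ : 0 ≤ ρ) (hc : ∀ n : ℕ, ‖c n‖ ≤ C * (ρ ^ n / n.factorial)) (h : M * ρ < ε) :
    HasSum (fun n => c n * ∫ x, K x * (y x : ℂ) ^ n) (∫ x, K x * ∑' n, c n * (y x : ℂ) ^ n) := by
  have hexp : ∀ t : ℝ, HasSum (fun n : ℕ => t ^ n / n.factorial) (Real.exp t) := fun t => by
    rw [Real.exp_eq_exp_ℝ]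
    exact NormedSpace.expSeries_div_hasSum_exp t
  -- The dominating series is itself an exponential; its sum decays at rate ε - Mρ > 0 and is
  -- therefore integrable.
  have hbs : ∀ x : Space d, HasSum (fun n : ℕ => C * (Real.exp (-(ε * ‖x‖)) * ‖x‖⁻¹) *
      ((M * ρ * ‖x‖) ^ n / n.factorial)) (C * (Real.exp (-((ε - M * ρ) * ‖x‖)) * ‖x‖⁻¹)) := by
    intro x
    have := (hexp (M * ρ * ‖x‖)).mul_left (C * (Real.exp (-(ε * ‖x‖)) * ‖x‖⁻¹))
    convert! this using 1
    have e : Real.exp (-((ε - M * ρ) * ‖x‖)) =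
        Real.exp (-(ε * ‖x‖)) * Real.exp (M * ρ * ‖x‖) := by
      rw [← Real.exp_add]
      ring_nf
    rw [e]
    ring
  have hcy : ∀ x n, ‖c n * (y x : ℂ) ^ n‖ ≤ C * ((M * ρ * ‖x‖) ^ n / n.factorial) := by
    intro x n
    rw [norm_mul, norm_pow, Complex.norm_real, Real.norm_eq_abs]
    calc ‖c n‖ * |y x| ^ n ≤ (C * (ρ ^ n / n.factorial)) * (M * ‖x‖) ^ n := by
          gcongr
          · exact hc n
          · exact hy x
      _ = _ := by rw [mul_pow, mul_pow, mul_pow]; ring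
  have hle : ∀ n x, ‖K x * (c n * (y x : ℂ) ^ n)‖ ≤ C * (Real.exp (-(ε * ‖x‖)) * ‖x‖⁻¹) *
      ((M * ρ * ‖x‖) ^ n / n.factorial) := by
    intro n x
    rw [norm_mul]
    calc ‖K x‖ * ‖c n * (y x : ℂ) ^ n‖
        ≤ (Real.exp (-(ε * ‖x‖)) * ‖x‖⁻¹) * (C * ((M * ρ * ‖x‖) ^ n / n.factorial)) := by
          gcongr
          · exact hK x
          · exact hcy x n
      _ = _ := by ring
  have key := hasSum_integral_of_dominated_convergence (μ := (volume : Measure (Space d)))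
    (F := fun n x => K x * (c n * (y x : ℂ) ^ n))
    (f := fun x => K x * ∑' n, c n * (y x : ℂ) ^ n)
    (fun n x => C * (Real.exp (-(ε * ‖x‖)) * ‖x‖⁻¹) * ((M * ρ * ‖x‖) ^ n / n.factorial))
    (fun n => hKm.mul (by fun_prop : Measurable fun x => c n * (y x : ℂ) ^ n).aestronglyMeasurable)
    (fun n => Eventually.of_forall (hle n))
    (Eventually.of_forall fun x => (hbs x).summable)
    (by
      simp_rw [fun x => (hbs x).tsum_eq]
      exact (integrable_exp_neg_norm_div_norm hd (by linarith)).const_mul C)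
    (Eventually.of_forall fun x => by
      refine HasSum.mul_left _ (Summable.hasSum ?_)
      exact Summable.of_norm_bounded (((hexp (M * ρ * ‖x‖)).summable).mul_left C) (hcy x))
  convert! key using 2 with n
  rw [← integral_const_mul]
  congr 1
  funext x
  ring

/-- From ‖a + n‖ ≤ (1 + ‖a‖/b)(b + n) each coefficient ratio is at most (1 + ‖a‖/b)/(n+1). Thus 𝐌
has exponential type at most 1 + ‖a‖/b, which a large ε outweighs term by term. -/
theorem norm_olverCoeff_le (a : ℂ) {b : ℝ} (hb : 0 < b) (n : ℕ) :
    ‖olverCoeff a b n‖ ≤ ‖olverCoeff a b 0‖ * ((1 + ‖a‖ / b) ^ n / n.factorial) := by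
  induction n with
  | zero => simp
  | succ n ih =>
    have hpos : 0 < (b + n) * ((n : ℝ) + 1) := by positivity
    have h := congrArg norm (olverCoeff_succ (a := a) (b := (b : ℂ)) (by simpa using hb) n)
    have e1 : ‖((b : ℂ) + n) * ((n : ℂ) + 1)‖ = (b + n) * (n + 1) := by
      rw [← Complex.norm_of_nonneg hpos.le]
      push_cast
      rfl
    have e2 : ‖a + n‖ ≤ (1 + ‖a‖ / b) * (b + n) := by
      refine (norm_add_le _ _).trans ?_
      rw [Complex.norm_natCast]
      have : (1 + ‖a‖ / b) * (b + n) = ‖a‖ + n + b + ‖a‖ / b * n := by field_simp; ring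
      rw [this]
      have : 0 ≤ ‖a‖ / b * n := by positivity
      linarith
    rw [norm_mul, e1, norm_mul] at h
    refine le_of_mul_le_mul_right ?_ hpos
    rw [h]
    calc ‖a + n‖ * ‖olverCoeff a b n‖
        ≤ ((1 + ‖a‖ / b) * (b + n)) *
          (‖olverCoeff a b 0‖ * ((1 + ‖a‖ / b) ^ n / n.factorial)) := by gcongr
      _ = _ := by
        rw [Nat.factorial_succ, pow_succ]
        have : (n.factorial : ℝ) ≠ 0 := by exact_mod_cast n.factorial_ne_zero
        push_cast
        field_simp

section ClosedForm

variable {d : ℕ}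

/-- The kernel `e^{-ε|x|} |x|⁻¹ e^{i k x·(θ - ξ)}`. -/
noncomputable def regKernel (ε k : ℝ) (θ ξ x : Space d) : ℂ :=
  ((Real.exp (-(ε * ‖x‖)) * ‖x‖⁻¹ : ℝ) : ℂ)
    * Complex.exp (Complex.I * ((k * inner ℝ x (θ - ξ) : ℝ) : ℂ))

/-- The parabolic coordinate `k (|x| - x·θ)`. -/
noncomputable def parabolicCoord (k : ℝ) (θ x : Space d) : ℝ := k * (‖x‖ - inner ℝ x θ)

theorem measurable_parabolicCoord (k : ℝ) (θ : Space d) : Measurable (parabolicCoord k θ) := by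
  unfold parabolicCoord
  fun_prop

theorem measurable_regKernel (ε k : ℝ) (θ ξ : Space d) : Measurable (regKernel ε k θ ξ) := by
  unfold regKernel
  fun_prop

theorem norm_exp_I_mul_ofReal (t : ℝ) : ‖Complex.exp (Complex.I * (t : ℂ))‖ = 1 := by
  rw [mul_comm, Complex.norm_exp_ofReal_mul_I]

theorem norm_regKernel (ε k : ℝ) (θ ξ x : Space d) :
    ‖regKernel ε k θ ξ x‖ = Real.exp (-(ε * ‖x‖)) * ‖x‖⁻¹ := by
  rw [regKernel, norm_mul, norm_exp_I_mul_ofReal, mul_one, Complex.norm_of_nonneg (by positivity)]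

theorem abs_parabolicCoord_le (k : ℝ) {θ : Space d} (hθ : ‖θ‖ = 1) (x : Space d) :
    |parabolicCoord k θ x| ≤ 2 * |k| * ‖x‖ := by
  have h := abs_real_inner_le_norm x θ
  rw [hθ, mul_one] at h
  have h2 : |‖x‖ - inner ℝ x θ| ≤ 2 * ‖x‖ := by
    rw [abs_le] at h ⊢
    constructor <;> linarith [norm_nonneg x]
  rw [parabolicCoord, abs_mul]
  nlinarith [abs_nonneg k]

theorem parabolicCoord_nonneg {k c : ℝ} (hk : 0 ≤ c * k) {θ : Space d} (hθ : ‖θ‖ = 1) (x : Space d) :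
    0 ≤ c * parabolicCoord k θ x := by
  have h := real_inner_le_norm x θ
  rw [hθ, mul_one] at h
  rw [parabolicCoord, ← mul_assoc]
  exact mul_nonneg hk (by linarith)

/-- The constant `(4π)^{d/2} / (2√π)`. -/
noncomputable def subordConst (d : ℕ) : ℝ := (4 * π) ^ ((d : ℝ) / 2) / (2 * √π)

/-- The exponential generating function of the moments of `parabolicCoord`. -/
theorem integral_regKernel_mul_exp (hd : 2 ≤ d) {ε k t : ℝ} {θ : Space d} (hθ : ‖θ‖ = 1)
    (ξ : Space d) (ht : 2 * |k| * |t| < ε) :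
    ∫ x, regKernel ε k θ ξ x * Complex.exp (t * parabolicCoord k θ x) =
      (subordConst d : ℂ) * ((((ε ^ 2 + k ^ 2 * ‖θ - ξ‖ ^ 2 : ℝ) : ℂ) - t *
        (2 * ε * k - 2 * Complex.I * k ^ 2 * (1 - ((inner ℝ θ ξ : ℝ) : ℂ))))
          ^ (-(((d : ℝ) - 1) / 2 : ℝ) : ℂ) * Complex.Gamma (((d : ℝ) - 1) / 2 : ℝ)) := by
  have htk : |t * k| = |k| * |t| := by rw [abs_mul, mul_comm]
  -- The factor e^{ty} with y = k(|x| - x·θ) lowers the decay rate to ε - tk and adds the real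
  -- frequency -tkθ. Since |θ| = 1, the t² terms of (ε - tk)² and |tkθ|² cancel, and the base of the
  -- power is affine in t.
  have hv : ‖(-(t * k)) • θ‖ < ε - t * k := by
    rw [norm_smul, hθ, mul_one, Real.norm_eq_abs, abs_neg, htk]
    linarith [le_abs_self (t * k)]
  have h := integral_exp_neg_norm_div_norm hd hv (k • (θ - ξ))
  have e1 : ∀ x : Space d, regKernel ε k θ ξ x * Complex.exp (t * parabolicCoord k θ x) =
      ((Real.exp (-((ε - t * k) * ‖x‖)) / ‖x‖ : ℝ) : ℂ) *
        Complex.exp (linForm ((-(t * k)) • θ) (k • (θ - ξ)) x) := by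
    intro x
    have e : Real.exp (-((ε - t * k) * ‖x‖)) = Real.exp (-(ε * ‖x‖)) * Real.exp (t * k * ‖x‖) := by
      rw [← Real.exp_add]
      ring_nf
    have e' : Complex.exp (t * parabolicCoord k θ x) =
        Complex.exp (t * k * ‖x‖) * Complex.exp ((-(t * k) * inner ℝ x θ : ℝ)) := by
      rw [← Complex.exp_add, parabolicCoord]
      push_cast
      ring_nf
    rw [regKernel, linForm, Complex.exp_add, e, e', real_inner_smul_left, real_inner_smul_left,
      real_inner_comm x θ, real_inner_comm x (θ - ξ)]
    push_cast
    ring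
  simp_rw [e1]
  rw [h, subordConst]
  congr 3
  have h1 : inner ℝ θ θ = (1 : ℝ) := by rw [real_inner_self_eq_norm_sq, hθ]; norm_num
  rw [complexSq, norm_smul, norm_smul, hθ, real_inner_smul_left, real_inner_smul_right,
    inner_sub_right, h1, mul_one, mul_pow, Real.norm_eq_abs, Real.norm_eq_abs, sq_abs, sq_abs]
  push_cast
  ring

/-- The moments of `parabolicCoord` against `regKernel`. -/
theorem integral_regKernel_mul_pow (hd : 2 ≤ d) {ε k : ℝ} (hε : 0 < ε) {θ : Space d}
    (hθ : ‖θ‖ = 1) (ξ : Space d) (n : ℕ) :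
    ∫ x, regKernel ε k θ ξ x * (parabolicCoord k θ x : ℂ) ^ n =
      (subordConst d : ℂ) * Complex.Gamma (((d : ℝ) - 1) / 2 : ℝ) *
        ((ε ^ 2 + k ^ 2 * ‖θ - ξ‖ ^ 2 : ℝ) : ℂ) ^ (-(((d : ℝ) - 1) / 2 : ℝ) : ℂ) *
        ((ascPochhammer ℂ n).eval ((((d : ℝ) - 1) / 2 : ℝ) : ℂ) *
        ((2 * ε * k - 2 * Complex.I * k ^ 2 * (1 - ((inner ℝ θ ξ : ℝ) : ℂ))) /
          ((ε ^ 2 + k ^ 2 * ‖θ - ξ‖ ^ 2 : ℝ) : ℂ)) ^ n) := by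
  have hA : 0 < ε ^ 2 + k ^ 2 * ‖θ - ξ‖ ^ 2 := by positivity
  have hA' : ((ε ^ 2 + k ^ 2 * ‖θ - ξ‖ ^ 2 : ℝ) : ℂ) ≠ 0 := by exact_mod_cast hA.ne'
  have hgen := fun t ht => integral_regKernel_mul_exp hd (ε := ε) (k := k) (t := t) hθ ξ ht
  generalize (2 * ε * k - 2 * Complex.I * k ^ 2 * (1 - ((inner ℝ θ ξ : ℝ) : ℂ)) : ℂ) = B at *
  generalize ε ^ 2 + k ^ 2 * ‖θ - ξ‖ ^ 2 = A at *
  generalize ((d : ℝ) - 1) / 2 = b at *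
  have hn : (n.factorial : ℂ) ≠ 0 := by exact_mod_cast n.factorial_ne_zero
  have hsmall : ∀ᶠ t : ℝ in 𝓝 0, 2 * |k| * |t| < ε := by
    have : Tendsto (fun t : ℝ => 2 * |k| * |t|) (𝓝 0) (𝓝 (2 * |k| * |0|)) :=
      (by fun_prop : Continuous fun t : ℝ => 2 * |k| * |t|).tendsto 0
    rw [abs_zero, mul_zero] at this
    exact this.eventually_lt_const hε
  have hsmall' : ∀ᶠ t : ℝ in 𝓝 0, ‖(t : ℂ) * (B / A)‖ < 1 := by
    have : Tendsto (fun t : ℝ => ‖(t : ℂ) * (B / A)‖) (𝓝 0) (𝓝 (‖((0 : ℝ) : ℂ) * (B / A)‖)) :=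
      (by fun_prop : Continuous fun t : ℝ => ‖(t : ℂ) * (B / A)‖).tendsto 0
    rw [Complex.ofReal_zero, zero_mul, norm_zero] at this
    exact this.eventually_lt_const one_pos
  -- Both expansions in t of the generating function: the exponential series under the integral, and
  -- the binomial series of (A - tB)^{-b}.
  have key := eq_of_hasSum_pow_smul
    (c := fun n => (∫ x, regKernel ε k θ ξ x * (parabolicCoord k θ x : ℂ) ^ n) / n.factorial)
    (c' := fun n => (subordConst d : ℂ) * Complex.Gamma b * (A : ℂ) ^ (-(b : ℂ)) *
      ((ascPochhammer ℂ n).eval (b : ℂ) / n.factorial * (B / A) ^ n))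
    (f := fun t => ∫ x, regKernel ε k θ ξ x * Complex.exp (t * parabolicCoord k θ x)) ?_ ?_
  · have h := congrFun key n
    rw [div_eq_iff hn] at h
    rw [h]
    field_simp
  · filter_upwards [hsmall] with t ht
    have h := hasSum_integral_mul_pow hd (measurable_regKernel ε k θ ξ).aestronglyMeasurable
      (fun x => (norm_regKernel ε k θ ξ x).le) (measurable_parabolicCoord k θ)
      (abs_parabolicCoord_le k hθ) (c := fun n => (t : ℂ) ^ n / n.factorial) zero_le_one
      (abs_nonneg t) (fun n => by simp) ht
    have e : ∀ x : Space d, ∑' n : ℕ, (t : ℂ) ^ n / n.factorial * (parabolicCoord k θ x : ℂ) ^ n =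
        Complex.exp (t * parabolicCoord k θ x) := by
      intro x
      rw [Complex.exp_eq_exp_ℂ, ← (NormedSpace.expSeries_div_hasSum_exp
        ((t : ℂ) * parabolicCoord k θ x)).tsum_eq]
      congr 1
      funext n
      ring
    simp_rw [e] at h
    convert! h using 2 with m
    rw [Complex.real_smul]
    push_cast
    ring
  · filter_upwards [hsmall, hsmall'] with t ht ht'
    rw [hgen t ht]
    have hne : 1 - (t : ℂ) * (B / A) ≠ 0 := by
      intro h0
      rw [← sub_eq_zero.1 h0, norm_one] at ht'
      exact lt_irrefl _ ht'
    have e : (A : ℂ) - t * B = A * (1 - t * (B / A)) := by field_simp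
    rw [e, ofReal_mul_cpow hA hne]
    have h := (hasSum_one_sub_cpow_neg (b : ℂ) ht').mul_left
      ((subordConst d : ℂ) * Complex.Gamma b * (A : ℂ) ^ (-(b : ℂ)))
    convert! h using 1
    · funext m
      rw [Complex.real_smul]
      push_cast
      ring
    · ring

end ClosedForm

end Coulomb

/-! ### Resummation for strong regularization. -/

namespace Coulomb

open Set Filter Topology

/-- For Re w > 0 the square w² is real only when w is, and then it is positive; adding s ≥ 0 cannot
reach the cut. With w = z and w = z - ik, both powers in `resolventFactor` are holomorphic on Re z >
0. -/
theorem sq_add_ofReal_mem_slitPlane {w : ℂ} (hw : 0 < w.re) {s : ℝ} (hs : 0 ≤ s) :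
    w ^ 2 + (s : ℂ) ∈ Complex.slitPlane := by
  rw [Complex.mem_slitPlane_iff]
  by_cases him : w.im = 0
  · left
    simp only [sq, Complex.add_re, Complex.mul_re, him, Complex.ofReal_re]
    nlinarith
  · right
    simp only [sq, Complex.add_im, Complex.mul_im, Complex.ofReal_im]
    intro h
    have : w.re * w.im = 0 := by linarith
    rcases mul_eq_zero.1 this with h | h
    · exact hw.ne' h
    · exact him h

variable {d : ℕ}

/-- `(z² + k²|θ - ξ|²)^{a - b} ((z - ik)² + k²|ξ|²)^{-a}` -/
noncomputable def resolventFactor (a b : ℂ) (k : ℝ) (θ ξ : Space d) (z : ℂ) : ℂ :=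
  (z ^ 2 + ((k ^ 2 * ‖θ - ξ‖ ^ 2 : ℝ) : ℂ)) ^ (a - b) *
    ((z - Complex.I * k) ^ 2 + ((k ^ 2 * ‖ξ‖ ^ 2 : ℝ) : ℂ)) ^ (-a)

theorem hasDerivAt_resolventFactor (a b : ℂ) (k : ℝ) (θ ξ : Space d) {z : ℂ} (hz : 0 < z.re) :
    HasDerivAt (resolventFactor a b k θ ξ)
      ((a - b) * (z ^ 2 + ((k ^ 2 * ‖θ - ξ‖ ^ 2 : ℝ) : ℂ)) ^ (a - b - 1) * (2 * z) *
          ((z - Complex.I * k) ^ 2 + ((k ^ 2 * ‖ξ‖ ^ 2 : ℝ) : ℂ)) ^ (-a) +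
        (z ^ 2 + ((k ^ 2 * ‖θ - ξ‖ ^ 2 : ℝ) : ℂ)) ^ (a - b) *
          (-a * ((z - Complex.I * k) ^ 2 + ((k ^ 2 * ‖ξ‖ ^ 2 : ℝ) : ℂ)) ^ (-a - 1) *
            (2 * (z - Complex.I * k)))) z := by
  have hz' : 0 < (z - Complex.I * k).re := by simpa using hz
  have h1 : HasDerivAt (fun z : ℂ => z ^ 2 + ((k ^ 2 * ‖θ - ξ‖ ^ 2 : ℝ) : ℂ)) (2 * z) z := by
    simpa using (hasDerivAt_pow 2 z).add_const ((k ^ 2 * ‖θ - ξ‖ ^ 2 : ℝ) : ℂ)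
  have h2 : HasDerivAt (fun z : ℂ => (z - Complex.I * k) ^ 2 + ((k ^ 2 * ‖ξ‖ ^ 2 : ℝ) : ℂ))
      (2 * (z - Complex.I * k)) z := by
    simpa using (((hasDerivAt_id z).sub_const (Complex.I * k)).pow 2).add_const
      ((k ^ 2 * ‖ξ‖ ^ 2 : ℝ) : ℂ)
  exact (h1.cpow_const (sq_add_ofReal_mem_slitPlane hz (by positivity))).mul
    (h2.cpow_const (sq_add_ofReal_mem_slitPlane hz' (by positivity)))

/-- The n-th moment carries Γ(b)(b)ₙ = Γ(b+n), which cancels the Gamma factor of the n-th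
coefficient of 𝐌. What remains is the binomial series of (1 - iB/A)^{-a}, and A - iB = (ε - ik)² +
k²|ξ|² because |θ| = 1. -/
theorem integral_regKernel_mul_olverM_of_large (hd : 2 ≤ d) (a : ℂ) (k : ℝ) {θ : Space d}
    (hθ : ‖θ‖ = 1) (ξ : Space d) :
    ∃ R : ℝ, 0 ≤ R ∧ ∀ ε : ℝ, R < ε →
      ∫ x, regKernel ε k θ ξ x * olverM a (((d : ℝ) - 1) / 2 : ℝ)
        (Complex.I * parabolicCoord k θ x) =
      (subordConst d : ℂ) * resolventFactor a (((d : ℝ) - 1) / 2 : ℝ) k θ ξ ε := by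
  have hd' : (2 : ℝ) ≤ d := by exact_mod_cast hd
  have hb : 0 < ((d : ℝ) - 1) / 2 := by linarith
  have hbre : 0 < ((((d : ℝ) - 1) / 2 : ℝ) : ℂ).re := by rwa [Complex.ofReal_re]
  have hG := Complex.Gamma_ne_zero_of_re_pos hbre
  set ρ : ℝ := 1 + ‖a‖ / (((d : ℝ) - 1) / 2) with hρ
  have hρ0 : 0 ≤ ρ := by positivity
  set S : ℝ := 2 * k ^ 2 * (1 + |inner ℝ θ ξ|) with hS
  have hS0 : 0 ≤ S := by positivity
  -- The first summand allows termwise integration; the others give |B| ≤ 2|k|ε + S < ε² ≤ A, so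
  -- that the binomial series converges.
  refine ⟨2 * |k| * ρ + (2 * |k| + S + 1), by positivity, fun ε hε => ?_⟩
  have hk0 : 0 ≤ 2 * |k| := by positivity
  have hkρ : 0 ≤ 2 * |k| * ρ := by positivity
  have hε0 : 0 < ε := by linarith
  have hmom := integral_regKernel_mul_pow hd (k := k) hε0 hθ ξ
  have hA : 0 < ε ^ 2 + k ^ 2 * ‖θ - ξ‖ ^ 2 := by positivity
  have hA' : ((ε ^ 2 + k ^ 2 * ‖θ - ξ‖ ^ 2 : ℝ) : ℂ) ≠ 0 := by exact_mod_cast hA.ne'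
  have hsum := hasSum_integral_mul_pow hd (measurable_regKernel ε k θ ξ).aestronglyMeasurable
      (fun x => (norm_regKernel ε k θ ξ x).le) (measurable_parabolicCoord k θ)
      (abs_parabolicCoord_le k hθ)
      (c := fun n => olverCoeff a (((d : ℝ) - 1) / 2 : ℝ) n * Complex.I ^ n)
      (norm_nonneg (olverCoeff a (((d : ℝ) - 1) / 2 : ℝ) 0)) hρ0
      (fun n => by
        rw [norm_mul, norm_pow, Complex.norm_I, one_pow, mul_one]
        exact norm_olverCoeff_le a hb n) (by linarith)
  have e : ∀ x : Space d, ∑' n : ℕ, olverCoeff a (((d : ℝ) - 1) / 2 : ℝ) n * Complex.I ^ n *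
      (parabolicCoord k θ x : ℂ) ^ n = olverM a (((d : ℝ) - 1) / 2 : ℝ)
        (Complex.I * parabolicCoord k θ x) := by
    intro x
    rw [olverM_eq_tsum]
    congr 1
    funext n
    rw [mul_pow, mul_assoc]
  simp_rw [e, hmom] at hsum
  rw [resolventFactor]
  have eD : (((ε : ℂ) - Complex.I * k) ^ 2 + ((k ^ 2 * ‖ξ‖ ^ 2 : ℝ) : ℂ)) =
      ((ε ^ 2 + k ^ 2 * ‖θ - ξ‖ ^ 2 : ℝ) : ℂ) - Complex.I * (2 * ε * k -
        2 * Complex.I * k ^ 2 * (1 - ((inner ℝ θ ξ : ℝ) : ℂ))) := by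
    rw [norm_sub_sq_real, hθ]
    push_cast
    linear_combination ((k : ℂ) ^ 2 - 2 * (k : ℂ) ^ 2 * (1 - ((inner ℝ θ ξ : ℝ) : ℂ))) * Complex.I_sq
  have eA : (ε : ℂ) ^ 2 + ((k ^ 2 * ‖θ - ξ‖ ^ 2 : ℝ) : ℂ) =
      ((ε ^ 2 + k ^ 2 * ‖θ - ξ‖ ^ 2 : ℝ) : ℂ) := by push_cast; ring
  have hB : ‖(2 * ε * k - 2 * Complex.I * k ^ 2 * (1 - ((inner ℝ θ ξ : ℝ) : ℂ)) : ℂ)‖ <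
      ε ^ 2 + k ^ 2 * ‖θ - ξ‖ ^ 2 := by
    have h1 : ‖(2 * ε * k - 2 * Complex.I * k ^ 2 * (1 - ((inner ℝ θ ξ : ℝ) : ℂ)) : ℂ)‖ ≤
        2 * |k| * ε + S := by
      refine (norm_sub_le _ _).trans (add_le_add ?_ ?_)
      · simp only [norm_mul, Complex.norm_real, Real.norm_eq_abs, Complex.norm_ofNat,
          abs_of_pos hε0]
        linarith
      · rw [← Complex.ofReal_one, ← Complex.ofReal_sub]
        simp only [norm_mul, norm_pow, Complex.norm_real, Real.norm_eq_abs, Complex.norm_ofNat,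
          Complex.norm_I, mul_one, sq_abs, hS]
        gcongr
        exact (abs_sub _ _).trans (by rw [abs_one])
    have h2 : 0 ≤ k ^ 2 * ‖θ - ξ‖ ^ 2 := by positivity
    nlinarith
  rw [eA, eD]
  generalize (2 * ε * k - 2 * Complex.I * k ^ 2 * (1 - ((inner ℝ θ ξ : ℝ) : ℂ)) : ℂ) = B at *
  generalize ε ^ 2 + k ^ 2 * ‖θ - ξ‖ ^ 2 = A at *
  generalize ((d : ℝ) - 1) / 2 = b at *
  have hu : ‖Complex.I * (B / A)‖ < 1 := by
    rw [norm_mul, Complex.norm_I, one_mul, norm_div, Complex.norm_of_nonneg hA.le,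
      div_lt_one hA]
    exact hB
  have hne : 1 - Complex.I * (B / A) ≠ 0 := by
    intro h0
    rw [← sub_eq_zero.1 h0, norm_one] at hu
    exact lt_irrefl _ hu
  have eAB : (A : ℂ) - Complex.I * B = A * (1 - Complex.I * (B / A)) := by field_simp
  have hbin := (hasSum_one_sub_cpow_neg a hu).mul_left
    ((subordConst d : ℂ) * (A : ℂ) ^ (-(b : ℂ)))
  have hbne : ∀ m : ℕ, (b : ℂ) ≠ -m := by
    intro m hm
    have := congrArg Complex.re hm
    simp at this
    have : (0 : ℝ) ≤ m := m.cast_nonneg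
    linarith
  have hu := hsum.unique (a₂ := (subordConst d : ℂ) * (A : ℂ) ^ (-(b : ℂ)) *
    (1 - Complex.I * (B / A)) ^ (-a)) (by
      convert! hbin using 1
      funext n
      have hGn : Complex.Gamma (b + n) ≠ 0 :=
        Complex.Gamma_ne_zero_of_re_pos (by simp; positivity)
      rw [← Complex.Gamma_add_nat_div_Gamma_eq (b : ℂ) hbne, olverCoeff, mul_pow]
      field_simp)
  rw [hu, eAB, ofReal_mul_cpow hA hne, Complex.cpow_sub _ _ hA', Complex.cpow_neg (A : ℂ) a,
    Complex.cpow_neg (A : ℂ) b]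
  have : (A : ℂ) ^ a ≠ 0 := by rw [Complex.cpow_ne_zero_iff]; exact Or.inl hA'
  field_simp

end Coulomb

/-! ### Analytic continuation to every positive regularization. -/

namespace Coulomb

open Set Filter Topology

variable {d : ℕ}

/-- The unnormalized plane wave `e^{i k x·θ} 𝐌(iλ; (d-1)/2; i k (|x| - x·θ))`. -/
noncomputable def coreWave (k lam : ℝ) (x θ : Space d) : ℂ :=
  Complex.exp (Complex.I * ((k * inner ℝ x θ : ℝ) : ℂ)) *
    olverM (Complex.I * lam) (((d : ℝ) - 1) / 2 : ℝ) (Complex.I * parabolicCoord k θ x)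

/-- The character `e^{-i k x·ξ}`. -/
noncomputable def character (k : ℝ) (x ξ : Space d) : ℂ :=
  Complex.exp (Complex.I * ((-(k * inner ℝ x ξ) : ℝ) : ℂ))

theorem norm_character (k : ℝ) (x ξ : Space d) : ‖character k x ξ‖ = 1 :=
  norm_exp_I_mul_ofReal _

theorem continuous_character (k : ℝ) :
    Continuous fun p : Space d × Space d => character k p.1 p.2 := by
  unfold character
  fun_prop

theorem half_dim_sub_one_re_pos (hd : 2 ≤ d) : 0 < ((((d : ℝ) - 1) / 2 : ℝ) : ℂ).re := by
  have hd' : (2 : ℝ) ≤ d := by exact_mod_cast hd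
  rw [Complex.ofReal_re]
  linarith

theorem continuous_coreWave (hd : 2 ≤ d) (k lam : ℝ) :
    Continuous fun p : Space d × Space d => coreWave k lam p.1 p.2 := by
  have h : Continuous fun p : Space d × Space d =>
      Complex.I * (parabolicCoord k p.2 p.1 : ℂ) := by
    unfold parabolicCoord
    fun_prop
  unfold coreWave
  exact (by fun_prop : Continuous fun p : Space d × Space d =>
    Complex.exp (Complex.I * ((k * inner ℝ p.1 p.2 : ℝ) : ℂ))).mul
    ((continuous_olverM (half_dim_sub_one_re_pos hd)).comp h)

/-- The condition λk > 0 puts the argument of 𝐌 on the half-axis where the energy estimate applies,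
and d ≥ 2 is the requirement b ≥ 1/2. -/
theorem norm_coreWave_le (hd : 2 ≤ d) {k lam : ℝ} (hk : 0 < lam * k) (x : Space d) {θ : Space d}
    (hθ : ‖θ‖ = 1) :
    ‖coreWave k lam x θ‖ ≤ ‖(Complex.Gamma (((d : ℝ) - 1) / 2 : ℝ))⁻¹‖ := by
  have hd' : (2 : ℝ) ≤ d := by exact_mod_cast hd
  rw [coreWave, norm_mul, norm_exp_I_mul_ofReal, one_mul]
  exact norm_olverM_le (left_ne_zero_of_mul hk.ne') (by linarith)
    (parabolicCoord_nonneg hk.le hθ x)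

theorem coreWave_mul_character (k lam : ℝ) (x θ ξ : Space d) :
    coreWave k lam x θ * character k x ξ =
      Complex.exp (Complex.I * ((k * inner ℝ x (θ - ξ) : ℝ) : ℂ)) *
        olverM (Complex.I * lam) (((d : ℝ) - 1) / 2 : ℝ) (Complex.I * parabolicCoord k θ x) := by
  have e : Complex.exp (Complex.I * ((k * inner ℝ x (θ - ξ) : ℝ) : ℂ)) =
      Complex.exp (Complex.I * ((k * inner ℝ x θ : ℝ) : ℂ)) * character k x ξ := by
    rw [character, ← Complex.exp_add, inner_sub_right]
    push_cast
    ring_nf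
  rw [e, coreWave]
  ring

theorem measurable_coreWave_mul_character (hd : 2 ≤ d) (k lam : ℝ) (θ ξ : Space d) :
    Measurable fun x : Space d => coreWave k lam x θ * character k x ξ :=
  (((continuous_coreWave hd k lam).comp (by fun_prop : Continuous fun x : Space d => (x, θ))).mul
    ((continuous_character k).comp (by fun_prop : Continuous fun x : Space d => (x, ξ)))).measurable

/-- The regularized Fourier transform of the Coulomb plane wave, divided by `|x|`. -/
theorem integral_exp_mul_coreWave_div_norm (hd : 2 ≤ d) {k lam : ℝ} (hk : 0 < lam * k)
    {θ : Space d} (hθ : ‖θ‖ = 1) (ξ : Space d) {z : ℂ} (hz : 0 < z.re) :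
    ∫ x : Space d, Complex.exp (-(z * ‖x‖)) *
        (((‖x‖⁻¹ : ℝ) : ℂ) * (coreWave k lam x θ * character k x ξ)) =
      (subordConst d : ℂ) *
        resolventFactor (Complex.I * lam) (((d : ℝ) - 1) / 2 : ℝ) k θ ξ z ∧
    ∫ x : Space d, -(‖x‖ * (Complex.exp (-(z * ‖x‖)) *
        (((‖x‖⁻¹ : ℝ) : ℂ) * (coreWave k lam x θ * character k x ξ)))) =
      (subordConst d : ℂ) *
        deriv (resolventFactor (Complex.I * lam) (((d : ℝ) - 1) / 2 : ℝ) k θ ξ) z := by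
  set h : Space d → ℂ := fun x => ((‖x‖⁻¹ : ℝ) : ℂ) * (coreWave k lam x θ * character k x ξ) with hh
  have hm : Measurable h := by
    have := measurable_coreWave_mul_character hd k lam θ ξ
    exact (by fun_prop : Measurable fun x : Space d => ((‖x‖⁻¹ : ℝ) : ℂ)).mul this
  have hint : ∀ ε : ℝ, 0 < ε → Integrable (fun x : Space d => Real.exp (-(ε * ‖x‖)) * ‖h x‖) := by
    intro ε hε
    refine ((integrable_exp_neg_norm_div_norm hd hε).mul_const
      ‖(Complex.Gamma (((d : ℝ) - 1) / 2 : ℝ))⁻¹‖).mono' ?_ (Eventually.of_forall fun x => ?_)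
    · exact ((by fun_prop : Measurable fun x : Space d => Real.exp (-(ε * ‖x‖))).mul
        hm.norm).aestronglyMeasurable
    · rw [norm_mul, norm_norm, Real.norm_of_nonneg (Real.exp_pos _).le, mul_assoc]
      gcongr
      rw [hh, norm_mul, norm_mul, norm_character, mul_one, Complex.norm_of_nonneg (by positivity)]
      gcongr
      exact norm_coreWave_le hd hk x hθ
  have hρ : ∀ᵐ x : Space d, 0 ≤ ‖x‖ := Eventually.of_forall fun x => norm_nonneg x
  have hd1 := fun {z : ℂ} (hz : 0 < z.re) => hasDerivAt_integral_exp_neg_mul hρ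
    measurable_norm hm.aestronglyMeasurable hint hz
  have hres := fun {z : ℂ} (hz : 0 < z.re) => hasDerivAt_resolventFactor (Complex.I * lam)
    (((d : ℝ) - 1) / 2 : ℝ) k θ ξ hz
  obtain ⟨R, hR0, hR⟩ := integral_regKernel_mul_olverM_of_large hd (Complex.I * lam) k hθ ξ
  have heq : ∀ {z : ℂ}, 0 < z.re → ∫ x : Space d, Complex.exp (-(z * ‖x‖)) * h x =
      (subordConst d : ℂ) *
        resolventFactor (Complex.I * lam) (((d : ℝ) - 1) / 2 : ℝ) k θ ξ z := by
    intro z hz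
    refine eq_of_eq_large_real (f := fun z : ℂ => ∫ x : Space d, Complex.exp (-(z * ‖x‖)) * h x)
      (g := fun z => (subordConst d : ℂ) *
        resolventFactor (Complex.I * lam) (((d : ℝ) - 1) / 2 : ℝ) k θ ξ z) (R := R)
      (fun w hw => (hd1 hw).differentiableAt.differentiableWithinAt)
      (fun w hw => ((hres hw).differentiableAt.const_mul _).differentiableWithinAt) ?_ hz
    intro ε hε
    rw [← hR ε hε]
    congr 1
    funext x
    simp only [hh]
    rw [coreWave_mul_character, regKernel]
    push_cast
    ring
  refine ⟨heq hz, ?_⟩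
  -- Differentiating the Laplace integral in z brings down -|x|, which compensates the weight 1/|x|;
  -- the closed form is differentiated alongside.
  have h1 := hd1 hz
  have h2 : HasDerivAt (fun z : ℂ => ∫ x : Space d, Complex.exp (-(z * ‖x‖)) * h x)
      ((subordConst d : ℂ) *
        deriv (resolventFactor (Complex.I * lam) (((d : ℝ) - 1) / 2 : ℝ) k θ ξ) z) z := by
    refine ((hres hz).differentiableAt.hasDerivAt.const_mul _).congr_of_eventuallyEq ?_
    filter_upwards [isOpen_re_pos.mem_nhds hz] with w hw using heq hw
  exact h1.unique h2

/-- The regularized momentum amplitude of the Coulomb plane wave. -/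
noncomputable def regAmplitude (k lam : ℝ) (θ ξ : Space d) (ε : ℝ) : ℂ :=
  2 * (Complex.I * lam) * (ε - Complex.I * k) *
      (((ε ^ 2 + k ^ 2 * ‖θ - ξ‖ ^ 2 : ℝ) : ℂ) ^ (Complex.I * lam - (((d : ℝ) - 1) / 2 : ℝ)) *
        (((ε : ℂ) - Complex.I * k) ^ 2 + ((k ^ 2 * ‖ξ‖ ^ 2 : ℝ) : ℂ)) ^ (-(Complex.I * lam) - 1)) -
    2 * ε * (Complex.I * lam - (((d : ℝ) - 1) / 2 : ℝ)) *
      (((ε ^ 2 + k ^ 2 * ‖θ - ξ‖ ^ 2 : ℝ) : ℂ) ^ (Complex.I * lam - (((d : ℝ) - 1) / 2 : ℝ) - 1) *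
        (((ε : ℂ) - Complex.I * k) ^ 2 + ((k ^ 2 * ‖ξ‖ ^ 2 : ℝ) : ℂ)) ^ (-(Complex.I * lam)))

/-- `regAmplitude` is minus the z-derivative of `resolventFactor` at z = ε, and |x|·|x|⁻¹ = 1 off
the null set {0}. -/
theorem integral_exp_mul_coreWave (hd : 2 ≤ d) {k lam : ℝ} (hk : 0 < lam * k) {θ : Space d}
    (hθ : ‖θ‖ = 1) (ξ : Space d) {ε : ℝ} (hε : 0 < ε) :
    ∫ x : Space d, ((Real.exp (-(ε * ‖x‖)) : ℝ) : ℂ) *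
        (coreWave k lam x θ * character k x ξ) =
      (subordConst d : ℂ) * regAmplitude k lam θ ξ ε := by
  have hε' : 0 < (ε : ℂ).re := by simpa
  have h := (integral_exp_mul_coreWave_div_norm hd hk hθ ξ hε').2
  rw [(hasDerivAt_resolventFactor (Complex.I * lam) (((d : ℝ) - 1) / 2 : ℝ) k θ ξ hε').deriv,
    integral_neg] at h
  have hne : ∀ᵐ x : Space d, x ≠ 0 := by
    have : NeZero d := ⟨by omega⟩
    simp [ae_iff, measure_singleton]
  have e : ∫ x : Space d, ((Real.exp (-(ε * ‖x‖)) : ℝ) : ℂ) *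
        (coreWave k lam x θ * character k x ξ) =
      ∫ x : Space d, ‖x‖ * (Complex.exp (-(ε * ‖x‖)) *
        (((‖x‖⁻¹ : ℝ) : ℂ) * (coreWave k lam x θ * character k x ξ))) := by
    refine integral_congr_ae ?_
    filter_upwards [hne] with x hx
    have hx' : (‖x‖ : ℂ) ≠ 0 := by exact_mod_cast (norm_pos_iff.2 hx).ne'
    push_cast
    field_simp
  rw [e, ← neg_inj, h, regAmplitude]
  push_cast
  ring

end Coulomb

/-! ### Removal of the regularization off the unit sphere. -/

namespace Coulomb

open Set Filter Topology

variable {d : ℕ}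

/-- The factor relating the momentum amplitude inside the unit sphere to that outside. -/
noncomputable def sideFactor (lam : ℝ) (ξ : Space d) : ℂ :=
  if ‖ξ‖ < 1 then -((Real.exp (-(π * |lam|)) : ℝ) : ℂ) else 1

/-- The momentum amplitude of the Coulomb plane wave away from the unit sphere. -/
noncomputable def amplitude (k lam : ℝ) (θ ξ : Space d) : ℂ :=
  2 * (Complex.I * lam) * (0 - Complex.I * k) *
    (((k ^ 2 * ‖θ - ξ‖ ^ 2 : ℝ) : ℂ) ^ (Complex.I * lam - (((d : ℝ) - 1) / 2 : ℝ)) *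
      (sideFactor lam ξ * ((k ^ 2 * |1 - ‖ξ‖ ^ 2| : ℝ) : ℂ) ^ (-(Complex.I * lam) - 1)))

theorem tendsto_sq_add_cpow_of_one_lt {k r : ℝ} (hk : k ≠ 0) (hr : 1 < r) (s : ℂ) :
    Tendsto (fun ε : ℝ => (((ε : ℂ) - Complex.I * k) ^ 2 + ((k ^ 2 * r ^ 2 : ℝ) : ℂ)) ^ s) (𝓝[>] 0)
      (𝓝 (((k ^ 2 * |1 - r ^ 2| : ℝ) : ℂ) ^ s)) := by
  have hpos : 0 < k ^ 2 * (r ^ 2 - 1) := by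
    have : 0 < r ^ 2 - 1 := by nlinarith
    positivity
  have hcont : Tendsto (fun ε : ℝ => ((ε : ℂ) - Complex.I * k) ^ 2 + ((k ^ 2 * r ^ 2 : ℝ) : ℂ))
      (𝓝 0) (𝓝 ((k ^ 2 * |1 - r ^ 2| : ℝ) : ℂ)) := by
    have h := (by fun_prop : Continuous fun ε : ℝ =>
      ((ε : ℂ) - Complex.I * k) ^ 2 + ((k ^ 2 * r ^ 2 : ℝ) : ℂ)).tendsto 0
    convert h using 2
    rw [abs_sub_comm, abs_of_pos (by nlinarith)]
    push_cast
    linear_combination (-(k : ℂ) ^ 2) * Complex.I_sq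
  refine ((continuousAt_cpow_const ?_).tendsto.comp hcont).mono_left nhdsWithin_le_nhds
  rw [abs_sub_comm, abs_of_pos (by nlinarith)]
  exact Or.inl (by rwa [Complex.ofReal_re])

/-- The base has imaginary part -2εk and tends to a negative number. It approaches the cut from
below for k > 0 and from above for k < 0, so its logarithm tends to the logarithm of the modulus
minus sgn(k)πi. -/
theorem tendsto_sq_add_cpow_of_lt_one {k r : ℝ} (hk : k ≠ 0) (hr0 : 0 ≤ r) (hr : r < 1) (s : ℂ) :
    Tendsto (fun ε : ℝ => (((ε : ℂ) - Complex.I * k) ^ 2 + ((k ^ 2 * r ^ 2 : ℝ) : ℂ)) ^ s) (𝓝[>] 0)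
      (𝓝 (Complex.exp (-(SignType.sign k : ℝ) * π * Complex.I * s) *
        ((k ^ 2 * |1 - r ^ 2| : ℝ) : ℂ) ^ s)) := by
  have hr2 : 0 < 1 - r ^ 2 := by nlinarith
  have hpos : 0 < k ^ 2 * (1 - r ^ 2) := by positivity
  set D₀ : ℂ := ((-(k ^ 2 * (1 - r ^ 2)) : ℝ) : ℂ) with hD₀
  have hre : D₀.re < 0 := by rw [hD₀, Complex.ofReal_re]; linarith
  have him : D₀.im = 0 := Complex.ofReal_im _
  have hnorm : ‖D₀‖ = k ^ 2 * (1 - r ^ 2) := by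
    rw [hD₀, Complex.norm_real, norm_neg, Real.norm_of_nonneg hpos.le]
  have hcont : Tendsto (fun ε : ℝ => ((ε : ℂ) - Complex.I * k) ^ 2 + ((k ^ 2 * r ^ 2 : ℝ) : ℂ))
      (𝓝[>] 0) (𝓝 D₀) := by
    have h := (by fun_prop : Continuous fun ε : ℝ =>
      ((ε : ℂ) - Complex.I * k) ^ 2 + ((k ^ 2 * r ^ 2 : ℝ) : ℂ)).tendsto 0
    convert h.mono_left nhdsWithin_le_nhds using 2
    rw [hD₀]
    push_cast
    linear_combination (-(k : ℂ) ^ 2) * Complex.I_sq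
  have hDim : ∀ ε : ℝ, (((ε : ℂ) - Complex.I * k) ^ 2 + ((k ^ 2 * r ^ 2 : ℝ) : ℂ)).im =
      -(2 * ε * k) := by
    intro ε
    simp only [sq, Complex.add_im, Complex.mul_im, Complex.sub_re, Complex.sub_im,
      Complex.ofReal_re, Complex.ofReal_im, Complex.mul_re, Complex.I_re, Complex.I_im]
    ring
  have hlog : Tendsto (fun ε : ℝ => Complex.log
      (((ε : ℂ) - Complex.I * k) ^ 2 + ((k ^ 2 * r ^ 2 : ℝ) : ℂ))) (𝓝[>] 0)
      (𝓝 (Real.log ‖D₀‖ + -(SignType.sign k : ℝ) * π * Complex.I)) := by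
    rcases hk.lt_or_gt with h | h
    · have h1 := Complex.tendsto_log_nhdsWithin_im_nonneg_of_re_neg_of_im_zero hre him
      have h2 := h1.comp (tendsto_nhdsWithin_iff.2 ⟨hcont, by
        filter_upwards [self_mem_nhdsWithin] with ε hε
        have hε' : (0 : ℝ) < ε := hε
        exact (hDim ε).symm ▸ by nlinarith⟩)
      convert! h2 using 2
      simp [sign_neg h]
    · have h1 := Complex.tendsto_log_nhdsWithin_im_neg_of_re_neg_of_im_zero hre him
      have h2 := h1.comp (tendsto_nhdsWithin_iff.2 ⟨hcont, by
        filter_upwards [self_mem_nhdsWithin] with ε hε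
        have hε' : (0 : ℝ) < ε := hε
        exact (hDim ε).symm ▸ by nlinarith⟩)
      convert! h2 using 2
      simp [sign_pos h, sub_eq_add_neg]
  have hexp := (Complex.continuous_exp.tendsto _).comp (hlog.mul_const s)
  have hlim : Complex.exp ((Real.log ‖D₀‖ + -(SignType.sign k : ℝ) * π * Complex.I) * s) =
      Complex.exp (-(SignType.sign k : ℝ) * π * Complex.I * s) *
        ((k ^ 2 * |1 - r ^ 2| : ℝ) : ℂ) ^ s := by
    rw [abs_of_pos hr2, hnorm, Complex.cpow_def_of_ne_zero (by exact_mod_cast hpos.ne'),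
      Complex.ofReal_log hpos.le, ← Complex.exp_add]
    ring_nf
  rw [hlim] at hexp
  refine hexp.congr' ?_
  filter_upwards [self_mem_nhdsWithin] with ε hε
  have hε' : (0 : ℝ) < ε := hε
  have hne : ((ε : ℂ) - Complex.I * k) ^ 2 + ((k ^ 2 * r ^ 2 : ℝ) : ℂ) ≠ 0 := by
    intro h
    have h1 := hDim ε
    rw [h, Complex.zero_im] at h1
    have : 2 * ε * k ≠ 0 := by positivity
    exact this (by linarith)
  simp only [Function.comp]
  rw [Complex.cpow_def_of_ne_zero hne]

/-- The phase at the exponent -iλ-1: as k and λ have the same sign, the part -iλ yields e^{-π|λ|}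
and the part -1 yields e^{±πi} = -1. This is the origin of the factor in the theorem. -/
theorem exp_sign_mul_eq {k lam : ℝ} (hk : 0 < lam * k) :
    Complex.exp (-(SignType.sign k : ℝ) * π * Complex.I * (-(Complex.I * lam) - 1)) =
      -((Real.exp (-(π * |lam|)) : ℝ) : ℂ) := by
  have h : (SignType.sign k : ℝ) * lam = |lam| := by
    rcases lt_or_gt_of_ne (right_ne_zero_of_mul hk.ne') with h | h
    · have : lam < 0 := by nlinarith
      simp [sign_neg h, abs_of_neg this]
    · have : 0 < lam := pos_of_mul_pos_left hk h.le
      simp [sign_pos h, abs_of_pos this]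
  have e : -((SignType.sign k : ℝ) : ℂ) * π * Complex.I * (-(Complex.I * lam) - 1) =
      ((-(π * |lam|) : ℝ) : ℂ) + ((SignType.sign k : ℝ) : ℂ) * (π * Complex.I) := by
    rw [← h]
    push_cast
    linear_combination (((SignType.sign k : ℝ) : ℂ) * π * lam) * Complex.I_sq
  rw [e, Complex.exp_add, ← Complex.ofReal_exp]
  rcases lt_or_gt_of_ne (right_ne_zero_of_mul hk.ne') with h | h
  · simp [sign_neg h, Complex.exp_neg]
  · simp [sign_pos h]

theorem norm_sub_ne_zero_of_norm_ne {θ ξ : Space d} (hθ : ‖θ‖ = 1) (hξ : ‖ξ‖ ≠ 1) :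
    0 < ‖θ - ξ‖ := by
  rw [norm_pos_iff, sub_ne_zero]
  rintro rfl
  exact hξ hθ

theorem tendsto_regAmplitude {k lam : ℝ} (hk : 0 < lam * k) {θ ξ : Space d} (hθ : ‖θ‖ = 1)
    (hξ : ‖ξ‖ ≠ 1) :
    Tendsto (regAmplitude k lam θ ξ) (𝓝[>] 0) (𝓝 (amplitude k lam θ ξ)) := by
  have hk0 : k ≠ 0 := right_ne_zero_of_mul hk.ne'
  have hθξ := norm_sub_ne_zero_of_norm_ne hθ hξ
  have hid : Tendsto (fun ε : ℝ => (ε : ℂ)) (𝓝[>] 0) (𝓝 0) := by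
    have := (Complex.continuous_ofReal.tendsto 0).mono_left (nhdsWithin_le_nhds (s := Ioi 0))
    rwa [Complex.ofReal_zero] at this
  have hA : ∀ s : ℂ, Tendsto (fun ε : ℝ => ((ε ^ 2 + k ^ 2 * ‖θ - ξ‖ ^ 2 : ℝ) : ℂ) ^ s) (𝓝[>] 0)
      (𝓝 (((k ^ 2 * ‖θ - ξ‖ ^ 2 : ℝ) : ℂ) ^ s)) := by
    intro s
    have h := (by fun_prop : Continuous fun ε : ℝ =>
      ((ε ^ 2 + k ^ 2 * ‖θ - ξ‖ ^ 2 : ℝ) : ℂ)).tendsto 0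
    have e : (((0 : ℝ) ^ 2 + k ^ 2 * ‖θ - ξ‖ ^ 2 : ℝ) : ℂ) = ((k ^ 2 * ‖θ - ξ‖ ^ 2 : ℝ) : ℂ) := by
      congr 1
      ring
    rw [e] at h
    refine ((continuousAt_cpow_const ?_).tendsto.comp h).mono_left nhdsWithin_le_nhds
    exact Or.inl (by rw [Complex.ofReal_re]; positivity)
  have hD : ∀ s : ℂ, ∃ L : ℂ, Tendsto (fun ε : ℝ =>
      (((ε : ℂ) - Complex.I * k) ^ 2 + ((k ^ 2 * ‖ξ‖ ^ 2 : ℝ) : ℂ)) ^ s) (𝓝[>] 0) (𝓝 L) := by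
    intro s
    rcases hξ.lt_or_gt with h | h
    · exact ⟨_, tendsto_sq_add_cpow_of_lt_one hk0 (norm_nonneg ξ) h s⟩
    · exact ⟨_, tendsto_sq_add_cpow_of_one_lt hk0 h s⟩
  have hD1 : Tendsto (fun ε : ℝ =>
      (((ε : ℂ) - Complex.I * k) ^ 2 + ((k ^ 2 * ‖ξ‖ ^ 2 : ℝ) : ℂ)) ^ (-(Complex.I * lam) - 1))
      (𝓝[>] 0) (𝓝 (sideFactor lam ξ *
        ((k ^ 2 * |1 - ‖ξ‖ ^ 2| : ℝ) : ℂ) ^ (-(Complex.I * lam) - 1))) := by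
    rcases hξ.lt_or_gt with h | h
    · rw [sideFactor, if_pos h, ← exp_sign_mul_eq hk]
      exact tendsto_sq_add_cpow_of_lt_one hk0 (norm_nonneg ξ) h _
    · rw [sideFactor, if_neg h.le.not_gt, one_mul]
      exact tendsto_sq_add_cpow_of_one_lt hk0 h _
  -- The value of this limit is immaterial: the second term of `regAmplitude` carries a factor ε and
  -- vanishes.
  obtain ⟨L, hL⟩ := hD (-(Complex.I * lam))
  have h1 := (((hid.sub_const (Complex.I * k)).const_mul (2 * (Complex.I * lam))).mul
    ((hA (Complex.I * lam - (((d : ℝ) - 1) / 2 : ℝ))).mul hD1)).sub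
    ((((hid.const_mul 2).mul_const (Complex.I * lam - (((d : ℝ) - 1) / 2 : ℝ)))).mul
      ((hA (Complex.I * lam - (((d : ℝ) - 1) / 2 : ℝ) - 1)).mul hL))
  rw [mul_zero, zero_mul, zero_mul, sub_zero] at h1
  exact h1

/-- A bound for the regularized amplitudes, uniform in the regularization and in `θ`. -/
noncomputable def amplitudeBound (d : ℕ) (k lam r : ℝ) : ℝ :=
  2 * |lam| * (1 + |k|) * ((k ^ 2 * (1 - r) ^ 2) ^ (-(((d : ℝ) - 1) / 2)) *
      ((k ^ 2 * |1 - r ^ 2|) ^ (-1 : ℝ) * Real.exp (π * |lam|))) +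
    2 * (|lam| + |((d : ℝ) - 1) / 2|) * ((k ^ 2 * (1 - r) ^ 2) ^ (-(((d : ℝ) - 1) / 2) - 1) *
      Real.exp (π * |lam|))

/-- Insensitive to the argument of z, hence usable while the base approaches the cut. -/
theorem norm_cpow_le_of_re {z s : ℂ} :
    ‖z ^ s‖ ≤ ‖z‖ ^ s.re * Real.exp (π * |s.im|) := by
  refine (Complex.norm_cpow_le z s).trans ?_
  rw [div_eq_mul_inv, ← Real.exp_neg]
  gcongr
  refine (neg_le_abs _).trans ?_
  rw [abs_mul]
  gcongr
  exact Complex.abs_arg_le_pi z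

/-- The expression factors as (ε - ik(1-r))(ε - ik(1+r)), and each factor dominates its imaginary
part. -/
theorem le_norm_sq_add (k ε r : ℝ) :
    k ^ 2 * |1 - r ^ 2| ≤ ‖((ε : ℂ) - Complex.I * k) ^ 2 + ((k ^ 2 * r ^ 2 : ℝ) : ℂ)‖ := by
  have e : ((ε : ℂ) - Complex.I * k) ^ 2 + ((k ^ 2 * r ^ 2 : ℝ) : ℂ) =
      ((ε : ℂ) - Complex.I * ((k * (1 - r) : ℝ) : ℂ)) *
        ((ε : ℂ) - Complex.I * ((k * (1 + r) : ℝ) : ℂ)) := by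
    push_cast
    linear_combination ((k : ℂ) ^ 2 * r ^ 2) * Complex.I_sq
  have h : ∀ t : ℝ, |t| ≤ ‖(ε : ℂ) - Complex.I * (t : ℂ)‖ := by
    intro t
    have := Complex.abs_im_le_norm ((ε : ℂ) - Complex.I * (t : ℂ))
    simpa using this
  rw [e, norm_mul]
  calc k ^ 2 * |1 - r ^ 2| = |k * (1 - r)| * |k * (1 + r)| := by
        rw [← abs_mul, show k * (1 - r) * (k * (1 + r)) = k ^ 2 * (1 - r ^ 2) by ring, abs_mul,
          abs_of_nonneg (sq_nonneg k)]
    _ ≤ _ := by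
        gcongr
        · exact h _
        · exact h _

/-- All powers have exponents with nonpositive real part, so lower bounds on the bases suffice:
|θ-ξ| ≥ |1-|ξ|| for the first base and `le_norm_sq_add` for the second. Neither involves ε or the
direction θ. -/
theorem norm_regAmplitude_le (hd : 2 ≤ d) {k lam : ℝ} (hk : 0 < lam * k) {θ ξ : Space d}
    (hθ : ‖θ‖ = 1) (hξ : ‖ξ‖ ≠ 1) {ε : ℝ} (hε : 0 < ε) (hε1 : ε ≤ 1) :
    ‖regAmplitude k lam θ ξ ε‖ ≤ amplitudeBound d k lam ‖ξ‖ := by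
  have hd' : (2 : ℝ) ≤ d := by exact_mod_cast hd
  have hk0 : k ≠ 0 := right_ne_zero_of_mul hk.ne'
  have hb : 0 < ((d : ℝ) - 1) / 2 := by linarith
  have h1r : (1 - ‖ξ‖) ≠ 0 := sub_ne_zero.2 hξ.symm
  have hA₀ : 0 < k ^ 2 * (1 - ‖ξ‖) ^ 2 := by positivity
  have hAle : k ^ 2 * (1 - ‖ξ‖) ^ 2 ≤ ε ^ 2 + k ^ 2 * ‖θ - ξ‖ ^ 2 := by
    have h := abs_norm_sub_norm_le θ ξ
    rw [hθ] at h
    have h2 : (1 - ‖ξ‖) ^ 2 ≤ ‖θ - ξ‖ ^ 2 := by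
      rw [← sq_abs]
      gcongr
    have h3 : k ^ 2 * (1 - ‖ξ‖) ^ 2 ≤ k ^ 2 * ‖θ - ξ‖ ^ 2 := by gcongr
    linarith [sq_nonneg ε]
  have hA : 0 < ε ^ 2 + k ^ 2 * ‖θ - ξ‖ ^ 2 := hA₀.trans_le hAle
  have hD₀ : 0 < k ^ 2 * |1 - ‖ξ‖ ^ 2| := by
    have : 1 - ‖ξ‖ ^ 2 ≠ 0 := by
      rw [show 1 - ‖ξ‖ ^ 2 = (1 - ‖ξ‖) * (1 + ‖ξ‖) by ring]
      exact mul_ne_zero h1r (by positivity)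
    positivity
  have hDle := le_norm_sq_add k ε ‖ξ‖
  have hApow : ∀ s : ℂ, s.re ≤ 0 → ‖((ε ^ 2 + k ^ 2 * ‖θ - ξ‖ ^ 2 : ℝ) : ℂ) ^ s‖ ≤
      (k ^ 2 * (1 - ‖ξ‖) ^ 2) ^ s.re := by
    intro s hs
    rw [Complex.norm_cpow_eq_rpow_re_of_pos hA]
    exact Real.rpow_le_rpow_of_nonpos hA₀ hAle hs
  rw [regAmplitude, amplitudeBound]
  generalize ((ε : ℂ) - Complex.I * k) ^ 2 + ((k ^ 2 * ‖ξ‖ ^ 2 : ℝ) : ℂ) = D at *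
  refine (norm_sub_le _ _).trans (add_le_add ?_ ?_)
  · rw [norm_mul, norm_mul (_ ^ _)]
    have h1 : ‖2 * (Complex.I * (lam : ℂ)) * (ε - Complex.I * k)‖ ≤ 2 * |lam| * (1 + |k|) := by
      rw [norm_mul]
      have e : ‖2 * (Complex.I * (lam : ℂ))‖ = 2 * |lam| := by simp
      rw [e]
      gcongr
      refine (norm_sub_le _ _).trans ?_
      rw [norm_mul, Complex.norm_I, one_mul, Complex.norm_real, Complex.norm_real,
        Real.norm_of_nonneg hε.le, Real.norm_eq_abs]
      gcongr
    have h2 := hApow (Complex.I * lam - (((d : ℝ) - 1) / 2 : ℝ)) (by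
      simp only [Complex.sub_re, Complex.mul_re, Complex.I_re, Complex.I_im, Complex.ofReal_re,
        Complex.ofReal_im]
      linarith)
    have e2 : (Complex.I * lam - (((d : ℝ) - 1) / 2 : ℝ) : ℂ).re = -(((d : ℝ) - 1) / 2) := by
      simp only [Complex.sub_re, Complex.mul_re, Complex.I_re, Complex.I_im, Complex.ofReal_re,
        Complex.ofReal_im]
      ring
    rw [e2] at h2
    have h3 := norm_cpow_le_of_re (z := D) (s := -(Complex.I * lam) - 1)
    have e3 : (-(Complex.I * lam) - 1 : ℂ).re = -1 := by simp
    have e4 : (-(Complex.I * lam) - 1 : ℂ).im = -lam := by simp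
    rw [e3, e4, abs_neg] at h3
    have h4 := h3.trans (mul_le_mul_of_nonneg_right
      (Real.rpow_le_rpow_of_nonpos hD₀ hDle (by norm_num : (-1 : ℝ) ≤ 0)) (Real.exp_pos _).le)
    gcongr
  · rw [norm_mul, norm_mul (_ ^ _)]
    have h1 : ‖2 * (ε : ℂ) * (Complex.I * lam - (((d : ℝ) - 1) / 2 : ℝ))‖ ≤
        2 * (|lam| + |((d : ℝ) - 1) / 2|) := by
      rw [norm_mul]
      have e : ‖2 * (ε : ℂ)‖ ≤ 2 := by
        rw [norm_mul, Complex.norm_real, Real.norm_of_nonneg hε.le, Complex.norm_ofNat]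
        linarith
      gcongr
      refine (norm_sub_le _ _).trans ?_
      rw [norm_mul, Complex.norm_I, one_mul, Complex.norm_real, Complex.norm_real,
        Real.norm_eq_abs, Real.norm_eq_abs]
    have e2 : (Complex.I * lam - (((d : ℝ) - 1) / 2 : ℝ) - 1 : ℂ).re =
        -(((d : ℝ) - 1) / 2) - 1 := by
      simp only [Complex.sub_re, Complex.mul_re, Complex.I_re, Complex.I_im, Complex.ofReal_re,
        Complex.ofReal_im, Complex.one_re]
      ring
    have h2 := hApow (Complex.I * lam - (((d : ℝ) - 1) / 2 : ℝ) - 1) (by rw [e2]; linarith)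
    rw [e2] at h2
    have h3 := norm_cpow_le_of_re (z := D) (s := -(Complex.I * lam))
    have e3 : (-(Complex.I * lam) : ℂ).re = 0 := by simp
    have e4 : (-(Complex.I * lam) : ℂ).im = -lam := by simp
    rw [e3, e4, abs_neg, Real.rpow_zero, one_mul] at h3
    gcongr

theorem continuousOn_amplitudeBound (d : ℕ) {k : ℝ} (hk : k ≠ 0) (lam : ℝ) :
    ContinuousOn (fun ξ : Space d => amplitudeBound d k lam ‖ξ‖) {ξ | ‖ξ‖ ≠ 1} := by
  have h1 : ∀ ξ ∈ {ξ : Space d | ‖ξ‖ ≠ 1}, k ^ 2 * (1 - ‖ξ‖) ^ 2 ≠ 0 := by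
    intro ξ hξ
    have : 1 - ‖ξ‖ ≠ 0 := sub_ne_zero.2 (Ne.symm hξ)
    positivity
  have h2 : ∀ ξ ∈ {ξ : Space d | ‖ξ‖ ≠ 1}, k ^ 2 * |1 - ‖ξ‖ ^ 2| ≠ 0 := by
    intro ξ hξ
    have h : 1 - ‖ξ‖ ≠ 0 := sub_ne_zero.2 (Ne.symm hξ)
    have : 1 - ‖ξ‖ ^ 2 ≠ 0 := by
      rw [show 1 - ‖ξ‖ ^ 2 = (1 - ‖ξ‖) * (1 + ‖ξ‖) by ring]
      exact mul_ne_zero h (by positivity)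
    positivity
  have c1 : ContinuousOn (fun ξ : Space d => k ^ 2 * (1 - ‖ξ‖) ^ 2) {ξ | ‖ξ‖ ≠ 1} := by fun_prop
  have c2 : ContinuousOn (fun ξ : Space d => k ^ 2 * |1 - ‖ξ‖ ^ 2|) {ξ | ‖ξ‖ ≠ 1} := by fun_prop
  have c3 := fun s : ℝ => c1.rpow_const (p := s) fun ξ hξ => Or.inl (h1 ξ hξ)
  have c4 := fun s : ℝ => c2.rpow_const (p := s) fun ξ hξ => Or.inl (h2 ξ hξ)
  unfold amplitudeBound
  exact (continuousOn_const.mul ((c3 _).mul ((c4 _).mul continuousOn_const))).add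
    (continuousOn_const.mul ((c3 _).mul continuousOn_const))

end Coulomb

/-! ### Superpositions over the sphere and their pairing with test functions. -/

namespace Coulomb

open Set Filter Topology

variable {d : ℕ}

theorem norm_sphere_coe (θ : Sphere d) : ‖(θ : Space d)‖ = 1 := mem_sphere_zero_iff_norm.1 θ.2

theorem integrable_exp_neg_norm (hd : 2 ≤ d) {ε : ℝ} (hε : 0 < ε) :
    Integrable fun x : Space d => Real.exp (-(ε * ‖x‖)) := by
  have : NeZero d := ⟨by omega⟩
  have hne : ∀ᵐ x : Space d, x ≠ 0 := by simp [ae_iff, measure_singleton]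
  refine ((integrable_exp_neg_norm_div_norm hd (half_pos hε)).const_mul (2 / ε)).mono'
    (by fun_prop : Measurable fun x : Space d => Real.exp (-(ε * ‖x‖))).aestronglyMeasurable ?_
  filter_upwards [hne] with x hx
  have hx' : 0 < ‖x‖ := norm_pos_iff.2 hx
  rw [Real.norm_of_nonneg (Real.exp_pos _).le]
  have h1 : ε / 2 * ‖x‖ ≤ Real.exp (ε / 2 * ‖x‖) := by
    linarith [Real.add_one_le_exp (ε / 2 * ‖x‖)]
  have h2 : (1 : ℝ) ≤ 2 / ε * ‖x‖⁻¹ * Real.exp (ε / 2 * ‖x‖) := by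
    calc (1 : ℝ) = 2 / ε * ‖x‖⁻¹ * (ε / 2 * ‖x‖) := by field_simp
      _ ≤ _ := by gcongr
  calc Real.exp (-(ε * ‖x‖)) = 1 * Real.exp (-(ε * ‖x‖)) := (one_mul _).symm
    _ ≤ (2 / ε * ‖x‖⁻¹ * Real.exp (ε / 2 * ‖x‖)) * Real.exp (-(ε * ‖x‖)) := by gcongr
    _ = 2 / ε * (Real.exp (-(ε / 2 * ‖x‖)) * ‖x‖⁻¹) := by
      rw [mul_assoc, ← Real.exp_add]
      ring_nf

section Superposition

variable {k lam : ℝ} {f : Sphere d → ℂ}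

/-- The superposition `∫ coreWave(x, θ) f(θ) dθ`. -/
noncomputable def superpose (k lam : ℝ) (f : Sphere d → ℂ) (x : Space d) : ℂ :=
  ∫ θ : Sphere d, coreWave k lam x θ * f θ ∂(sphereMeasure d)

theorem continuous_superpose (hd : 2 ≤ d) (hk : 0 < lam * k)
    (hf : Integrable f (sphereMeasure d)) : Continuous (superpose k lam f) := by
  refine continuous_of_dominated
    (bound := fun θ => ‖(Complex.Gamma (((d : ℝ) - 1) / 2 : ℝ))⁻¹‖ * ‖f θ‖) ?_ ?_
    (hf.norm.const_mul _) ?_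
  · intro x
    exact ((continuous_coreWave hd k lam).comp
      (by fun_prop : Continuous fun θ : Sphere d => (x, (θ : Space d)))).aestronglyMeasurable.mul
      hf.aestronglyMeasurable
  · intro x
    refine Eventually.of_forall fun θ => ?_
    rw [norm_mul]
    gcongr
    exact norm_coreWave_le hd hk x (norm_sphere_coe θ)
  · refine Eventually.of_forall fun θ => ?_
    exact ((continuous_coreWave hd k lam).comp
      (by fun_prop : Continuous fun x : Space d => (x, (θ : Space d)))).mul continuous_const

theorem norm_superpose_le (hd : 2 ≤ d) (hk : 0 < lam * k)
    (hf : Integrable f (sphereMeasure d)) (x : Space d) :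
    ‖superpose k lam f x‖ ≤
      ‖(Complex.Gamma (((d : ℝ) - 1) / 2 : ℝ))⁻¹‖ * ∫ θ, ‖f θ‖ ∂(sphereMeasure d) := by
  rw [← integral_const_mul]
  refine norm_integral_le_of_norm_le (hf.norm.const_mul _) (Eventually.of_forall fun θ => ?_)
  rw [norm_mul]
  gcongr
  exact norm_coreWave_le hd hk x (norm_sphere_coe θ)

section Pairing

variable {Θ : Type*} [MeasurableSpace Θ] {σ : Measure Θ} [SFinite σ] {ι : Θ → Space d}
  {F : Θ → ℂ} {φ : Space d → ℂ}

/-- The integrand of the regularized pairing of a superposition with a Fourier integral. -/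
noncomputable def pairingIntegrand (k lam ε : ℝ) (ι : Θ → Space d) (F : Θ → ℂ) (φ : Space d → ℂ)
    (x : Space d) (p : Θ × Space d) : ℂ :=
  ((Real.exp (-(ε * ‖x‖)) : ℝ) : ℂ) *
    ((coreWave k lam x (ι p.1) * F p.1) * (φ p.2 * character k x p.2))

theorem measurable_coreWave (hd : 2 ≤ d) (k lam : ℝ) :
    Measurable (fun p : Space d × Space d => coreWave k lam p.1 p.2) :=
  (continuous_coreWave hd k lam).measurable

theorem measurable_character (k : ℝ) :
    Measurable (fun p : Space d × Space d => character k p.1 p.2) :=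
  (continuous_character k).measurable

theorem aestronglyMeasurable_triple_mul {α β γ : Type*} [MeasurableSpace α] [MeasurableSpace β]
    [MeasurableSpace γ] {δ : Type*} [MeasurableSpace δ] {μ : Measure α} {ν : Measure β} {ρ : Measure γ} [SFinite ν] [SFinite ρ]
    {e : α → ℂ} {g : α × δ → ℂ} {j : β → δ} {h : α × γ → ℂ} {u : β → ℂ} {v : γ → ℂ}
    (he : Measurable e) (hg : Measurable g) (hj : Measurable j) (hh : Measurable h)
    (hu : AEStronglyMeasurable u ν) (hv : AEStronglyMeasurable v ρ) :
    AEStronglyMeasurable (fun q : α × (β × γ) =>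
      e q.1 * ((g (q.1, j q.2.1) * u q.2.1) * (v q.2.2 * h (q.1, q.2.2)))) (μ.prod (ν.prod ρ)) := by
  have m1 : AEStronglyMeasurable (fun q : α × (β × γ) => u q.2.1) (μ.prod (ν.prod ρ)) :=
    AEStronglyMeasurable.comp_snd (f := fun p : β × γ => u p.1)
      (AEStronglyMeasurable.comp_fst (f := u) hu)
  have m2 : AEStronglyMeasurable (fun q : α × (β × γ) => v q.2.2) (μ.prod (ν.prod ρ)) :=
    AEStronglyMeasurable.comp_snd (f := fun p : β × γ => v p.2)
      (AEStronglyMeasurable.comp_snd (f := v) hv)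
  have m3 : Measurable fun q : α × (β × γ) => e q.1 := he.comp measurable_fst
  have m4 : Measurable fun q : α × (β × γ) => g (q.1, j q.2.1) :=
    hg.comp (measurable_fst.prodMk (hj.comp measurable_snd.fst))
  have m5 : Measurable fun q : α × (β × γ) => h (q.1, q.2.2) :=
    hh.comp (measurable_fst.prodMk measurable_snd.snd)
  exact m3.aestronglyMeasurable.mul ((m4.aestronglyMeasurable.mul m1).mul
    (m2.mul m5.aestronglyMeasurable))

theorem aestronglyMeasurable_pairingIntegrand (hd : 2 ≤ d) (ε : ℝ) (hι : Measurable ι)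
    (hF : AEStronglyMeasurable F σ) (hφ : AEStronglyMeasurable φ) :
    AEStronglyMeasurable (fun q : Space d × (Θ × Space d) =>
      pairingIntegrand k lam ε ι F φ q.1 q.2) ((volume : Measure (Space d)).prod (σ.prod volume)) := by
  have he : Measurable fun x : Space d => ((Real.exp (-(ε * ‖x‖)) : ℝ) : ℂ) := by fun_prop
  have := aestronglyMeasurable_triple_mul (μ := (volume : Measure (Space d))) he
    (measurable_coreWave hd k lam) hι (measurable_character k) hF hφ
  unfold pairingIntegrand
  exact this

theorem integrable_pairingIntegrand (hd : 2 ≤ d) (hk : 0 < lam * k) (hι : Measurable ι)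
    (hι1 : ∀ θ, ‖ι θ‖ = 1) (hF : Integrable F σ) (hφ : Integrable φ) {ε : ℝ} (hε : 0 < ε) :
    Integrable (fun q : Space d × (Θ × Space d) => pairingIntegrand k lam ε ι F φ q.1 q.2)
      ((volume : Measure (Space d)).prod (σ.prod volume)) := by
  have hb := (integrable_exp_neg_norm hd hε).mul_prod (hF.norm.mul_prod hφ.norm)
  refine (hb.const_mul ‖(Complex.Gamma (((d : ℝ) - 1) / 2 : ℝ))⁻¹‖).mono'
    (aestronglyMeasurable_pairingIntegrand hd ε hι hF.aestronglyMeasurable hφ.aestronglyMeasurable)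
    (Eventually.of_forall fun q => ?_)
  have hc := norm_coreWave_le hd hk q.1 (hι1 q.2.1)
  rw [pairingIntegrand, norm_mul, norm_mul, norm_mul, norm_mul, norm_character, mul_one,
    Complex.norm_real, Real.norm_of_nonneg (Real.exp_pos _).le]
  calc Real.exp (-(ε * ‖q.1‖)) * (‖coreWave k lam q.1 (ι q.2.1)‖ * ‖F q.2.1‖ * ‖φ q.2.2‖)
      ≤ Real.exp (-(ε * ‖q.1‖)) *
        (‖(Complex.Gamma (((d : ℝ) - 1) / 2 : ℝ))⁻¹‖ * ‖F q.2.1‖ * ‖φ q.2.2‖) := by gcongr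
    _ = _ := by ring

/-- With e^{-ε|x|} present the triple integral converges absolutely, so x can be integrated first,
producing the regularized amplitude. -/
theorem integral_exp_mul_coreWave_superposition (hd : 2 ≤ d) (hk : 0 < lam * k)
    (hι : Measurable ι) (hι1 : ∀ θ, ‖ι θ‖ = 1) (hF : Integrable F σ) (hφ : Integrable φ) {ε : ℝ}
    (hε : 0 < ε) :
    ∫ x : Space d, ((Real.exp (-(ε * ‖x‖)) : ℝ) : ℂ) *
        ((∫ θ, coreWave k lam x (ι θ) * F θ ∂σ) * ∫ ξ, φ ξ * character k x ξ) =
      ∫ p : Θ × Space d, F p.1 * φ p.2 *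
        ((subordConst d : ℂ) * regAmplitude k lam (ι p.1) p.2 ε) ∂(σ.prod volume) := by
  have h1 : ∀ x : Space d, ((Real.exp (-(ε * ‖x‖)) : ℝ) : ℂ) *
        ((∫ θ, coreWave k lam x (ι θ) * F θ ∂σ) * ∫ ξ, φ ξ * character k x ξ) =
      ∫ p, pairingIntegrand k lam ε ι F φ x p ∂(σ.prod volume) := by
    intro x
    unfold pairingIntegrand
    rw [integral_const_mul, integral_prod_mul (fun θ => coreWave k lam x (ι θ) * F θ)
      (fun ξ => φ ξ * character k x ξ)]
  simp_rw [h1]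
  rw [integral_integral_swap (integrable_pairingIntegrand hd hk hι hι1 hF hφ hε)]
  congr 1
  funext p
  rw [← integral_exp_mul_coreWave hd hk (hι1 p.1) p.2 hε, ← integral_const_mul]
  congr 1
  funext x
  rw [pairingIntegrand]
  ring

end Pairing

theorem integral_exp_mul_superpose (hd : 2 ≤ d) (hk : 0 < lam * k)
    (hf : Integrable f (sphereMeasure d)) {φ : Space d → ℂ} (hφ : Integrable φ) {ε : ℝ}
    (hε : 0 < ε) :
    ∫ x : Space d, ((Real.exp (-(ε * ‖x‖)) : ℝ) : ℂ) *
        (superpose k lam f x * ∫ ξ, φ ξ * character k x ξ) =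
      ∫ p : Sphere d × Space d, f p.1 * φ p.2 *
        ((subordConst d : ℂ) * regAmplitude k lam (p.1 : Space d) p.2 ε)
        ∂((sphereMeasure d).prod volume) :=
  integral_exp_mul_coreWave_superposition hd hk measurable_subtype_coe norm_sphere_coe hf hφ hε

theorem measurable_regAmplitude (k lam ε : ℝ) :
    Measurable fun p : Sphere d × Space d => regAmplitude k lam (p.1 : Space d) p.2 ε := by
  have h1 : Measurable fun p : Sphere d × Space d =>
      ((ε ^ 2 + k ^ 2 * ‖(p.1 : Space d) - p.2‖ ^ 2 : ℝ) : ℂ) := by fun_prop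
  have h2 : Measurable fun p : Sphere d × Space d =>
      ((ε : ℂ) - Complex.I * k) ^ 2 + ((k ^ 2 * ‖p.2‖ ^ 2 : ℝ) : ℂ) := by fun_prop
  unfold regAmplitude
  exact (((h1.pow_const _).mul (h2.pow_const _)).const_mul _).sub
    (((h1.pow_const _).mul (h2.pow_const _)).const_mul _)

theorem measurable_sideFactor (lam : ℝ) : Measurable (sideFactor (d := d) lam) :=
  Measurable.ite (measurableSet_lt measurable_norm measurable_const) measurable_const
    measurable_const

theorem measurable_amplitude (k lam : ℝ) :
    Measurable fun p : Sphere d × Space d => amplitude k lam (p.1 : Space d) p.2 := by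
  have h1 : Measurable fun p : Sphere d × Space d =>
      ((k ^ 2 * ‖(p.1 : Space d) - p.2‖ ^ 2 : ℝ) : ℂ) := by fun_prop
  have h2 : Measurable fun p : Sphere d × Space d =>
      ((k ^ 2 * |1 - ‖p.2‖ ^ 2| : ℝ) : ℂ) := by fun_prop
  have h3 : Measurable fun p : Sphere d × Space d => sideFactor lam p.2 :=
    (measurable_sideFactor lam).comp measurable_snd
  unfold amplitude
  exact ((h1.pow_const _).mul (h3.mul (h2.pow_const _))).const_mul _

theorem norm_amplitude_le (hd : 2 ≤ d) (hk : 0 < lam * k) {θ ξ : Space d}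
    (hθ : ‖θ‖ = 1) (hξ : ‖ξ‖ ≠ 1) : ‖amplitude k lam θ ξ‖ ≤ amplitudeBound d k lam ‖ξ‖ := by
  refine le_of_tendsto (tendsto_regAmplitude hk hθ hξ).norm ?_
  filter_upwards [Ioc_mem_nhdsGT (zero_lt_one' ℝ)] with ε hε
  exact norm_regAmplitude_le hd hk hθ hξ hε.1 hε.2

theorem amplitudeBound_nonneg (d : ℕ) (k lam r : ℝ) : 0 ≤ amplitudeBound d k lam r := by
  unfold amplitudeBound
  positivity

/-- The limit ε → 0 of the regularized identity. On the left the domination is by a bounded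
superposition times an integrable transform; on the right by `amplitudeBound`, which is bounded on
the support of φ, a compact set off the unit sphere. -/
theorem integral_superpose_mul (hd : 2 ≤ d) (hk : 0 < lam * k)
    (hf : Integrable f (sphereMeasure d)) {φ : Space d → ℂ} (hφ : Continuous φ)
    (hφc : HasCompactSupport φ) (hφs : tsupport φ ⊆ {ξ | ‖ξ‖ ≠ 1})
    (hΦ : Integrable fun x => ∫ ξ, φ ξ * character k x ξ) :
    ∫ x : Space d, superpose k lam f x * ∫ ξ, φ ξ * character k x ξ =
      ∫ ξ, φ ξ * ((subordConst d : ℂ) *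
        ∫ θ : Sphere d, amplitude k lam (θ : Space d) ξ * f θ ∂(sphereMeasure d)) := by
  have hφi : Integrable φ := hφ.integrable_of_hasCompactSupport hφc
  have hmφ : Integrable (fun ξ => φ ξ * ((amplitudeBound d k lam ‖ξ‖ : ℝ) : ℂ)) := by
    have hcont : Continuous fun ξ => φ ξ * ((amplitudeBound d k lam ‖ξ‖ : ℝ) : ℂ) := by
      refine continuous_of_tsupport fun ξ hξ => ?_
      have hU : IsOpen {ξ : Space d | ‖ξ‖ ≠ 1} :=
        isOpen_ne_fun continuous_norm continuous_const
      have hξ' := hφs (tsupport_mul_subset_left hξ)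
      exact hφ.continuousAt.mul (Complex.continuous_ofReal.continuousAt.comp
        ((continuousOn_amplitudeBound d (right_ne_zero_of_mul hk.ne') lam).continuousAt
          (hU.mem_nhds hξ')))
    exact hcont.integrable_of_hasCompactSupport hφc.mul_right
  have hdom : Integrable (fun p : Sphere d × Space d => |subordConst d| *
      (‖f p.1‖ * ‖φ p.2 * ((amplitudeBound d k lam ‖p.2‖ : ℝ) : ℂ)‖))
      ((sphereMeasure d).prod volume) := (hf.norm.mul_prod hmφ.norm).const_mul _
  -- The bound on z is only needed off the unit sphere: where φ vanishes both sides are 0.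
  have hdomle : ∀ (p : Sphere d × Space d) (z : ℂ),
      (‖p.2‖ ≠ 1 → ‖z‖ ≤ amplitudeBound d k lam ‖p.2‖) →
      ‖f p.1 * φ p.2 * ((subordConst d : ℂ) * z)‖ ≤ |subordConst d| *
        (‖f p.1‖ * ‖φ p.2 * ((amplitudeBound d k lam ‖p.2‖ : ℝ) : ℂ)‖) := by
    intro p z hz
    by_cases h0 : φ p.2 = 0
    · simp [h0]
    have hp := hφs (subset_tsupport φ h0)
    have h1 := hz hp
    rw [norm_mul, norm_mul, norm_mul, norm_mul, Complex.norm_real, Complex.norm_real,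
      Real.norm_eq_abs, Real.norm_of_nonneg (amplitudeBound_nonneg d k lam _)]
    calc ‖f p.1‖ * ‖φ p.2‖ * (|subordConst d| * ‖z‖)
        ≤ ‖f p.1‖ * ‖φ p.2‖ * (|subordConst d| * amplitudeBound d k lam ‖p.2‖) := by gcongr
      _ = _ := by ring
  have hfφ : AEStronglyMeasurable (fun p : Sphere d × Space d => f p.1 * φ p.2)
      ((sphereMeasure d).prod volume) := (hf.mul_prod hφi).aestronglyMeasurable
  have hψΦ : Integrable fun x => superpose k lam f x * ∫ ξ, φ ξ * character k x ξ :=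
    hΦ.bdd_mul (continuous_superpose hd hk hf).aestronglyMeasurable
      (Eventually.of_forall (norm_superpose_le hd hk hf))
  have hL : Tendsto (fun ε : ℝ => ∫ x : Space d, ((Real.exp (-(ε * ‖x‖)) : ℝ) : ℂ) *
        (superpose k lam f x * ∫ ξ, φ ξ * character k x ξ)) (𝓝[>] 0)
      (𝓝 (∫ x : Space d, superpose k lam f x * ∫ ξ, φ ξ * character k x ξ)) := by
    refine tendsto_integral_filter_of_dominated_convergence
      (fun x => ‖superpose k lam f x * ∫ ξ, φ ξ * character k x ξ‖) ?_ ?_ hψΦ.norm ?_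
    · refine Eventually.of_forall fun ε => ?_
      exact (by fun_prop : Continuous fun x : Space d =>
        ((Real.exp (-(ε * ‖x‖)) : ℝ) : ℂ)).aestronglyMeasurable.mul hψΦ.aestronglyMeasurable
    · filter_upwards [self_mem_nhdsWithin] with ε hε
      have hε' : (0 : ℝ) < ε := hε
      refine Eventually.of_forall fun x => ?_
      rw [norm_mul, Complex.norm_real, Real.norm_of_nonneg (Real.exp_pos _).le]
      refine mul_le_of_le_one_left (norm_nonneg _) (Real.exp_le_one_iff.2 ?_)
      have : 0 ≤ ε * ‖x‖ := by positivity
      linarith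
    · refine Eventually.of_forall fun x => ?_
      have h := ((by fun_prop : Continuous fun ε : ℝ =>
        ((Real.exp (-(ε * ‖x‖)) : ℝ) : ℂ)).tendsto 0).mono_left (nhdsWithin_le_nhds (s := Ioi 0))
      have h2 := h.mul_const (superpose k lam f x * ∫ ξ, φ ξ * character k x ξ)
      simpa using h2
  have hR : Tendsto (fun ε : ℝ => ∫ p : Sphere d × Space d, f p.1 * φ p.2 *
        ((subordConst d : ℂ) * regAmplitude k lam (p.1 : Space d) p.2 ε)
        ∂((sphereMeasure d).prod volume)) (𝓝[>] 0)
      (𝓝 (∫ p : Sphere d × Space d, f p.1 * φ p.2 *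
        ((subordConst d : ℂ) * amplitude k lam (p.1 : Space d) p.2)
        ∂((sphereMeasure d).prod volume))) := by
    refine tendsto_integral_filter_of_dominated_convergence _ ?_ ?_ hdom ?_
    · exact Eventually.of_forall fun ε => hfφ.mul
        ((measurable_regAmplitude k lam ε).const_mul _).aestronglyMeasurable
    · filter_upwards [Ioc_mem_nhdsGT (zero_lt_one' ℝ)] with ε hε
      exact Eventually.of_forall fun p => hdomle p _ fun hp =>
        norm_regAmplitude_le hd hk (norm_sphere_coe p.1) hp hε.1 hε.2
    · refine Eventually.of_forall fun p => ?_
      by_cases h0 : φ p.2 = 0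
      · simp [h0]
      exact ((tendsto_regAmplitude hk (norm_sphere_coe p.1)
        (hφs (subset_tsupport φ h0))).const_mul _).const_mul _
  have hEq := tendsto_nhds_unique hL (hR.congr' (by
    filter_upwards [self_mem_nhdsWithin] with ε hε
    exact (integral_exp_mul_superpose hd hk hf hφi hε).symm))
  rw [hEq, integral_prod_symm]
  · congr 1
    funext ξ
    rw [← integral_const_mul, ← integral_const_mul]
    congr 1
    funext θ
    ring
  · refine hdom.mono' (hfφ.mul ((measurable_amplitude k lam).const_mul _).aestronglyMeasurable)
      (Eventually.of_forall fun p => hdomle p _ fun hp =>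
        norm_amplitude_le hd hk (norm_sphere_coe p.1) hp)

/-! ### Continuity and inversion law of the limiting amplitude. -/

theorem continuousAt_amplitude (hk : k ≠ 0) {θ ξ : Space d} (hθ : ‖θ‖ = 1) (hξ : ‖ξ‖ ≠ 1) :
    ContinuousAt (amplitude k lam θ) ξ := by
  have hside : ContinuousAt (sideFactor (d := d) lam) ξ := by
    rcases hξ.lt_or_gt with h | h
    · refine continuousAt_const.congr (f := fun _ => -((Real.exp (-(π * |lam|)) : ℝ) : ℂ)) ?_
      filter_upwards [(isOpen_lt continuous_norm continuous_const).mem_nhds h] with η hη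
      rw [sideFactor, if_pos hη]
    · refine continuousAt_const.congr (f := fun _ => (1 : ℂ)) ?_
      filter_upwards [(isOpen_lt continuous_const continuous_norm).mem_nhds h] with η hη
      have hη' : 1 < ‖η‖ := hη
      rw [sideFactor, if_neg hη'.le.not_gt]
  have hθξ := norm_sub_ne_zero_of_norm_ne hθ hξ
  have hξ2 : 1 - ‖ξ‖ ^ 2 ≠ 0 := by
    rw [show 1 - ‖ξ‖ ^ 2 = (1 - ‖ξ‖) * (1 + ‖ξ‖) by ring]
    exact mul_ne_zero (sub_ne_zero.2 hξ.symm) (by positivity)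
  have h1 : ContinuousAt (fun ξ : Space d => ((k ^ 2 * ‖θ - ξ‖ ^ 2 : ℝ) : ℂ)) ξ :=
    Continuous.continuousAt (by fun_prop)
  have h2 : ContinuousAt (fun ξ : Space d => ((k ^ 2 * |1 - ‖ξ‖ ^ 2| : ℝ) : ℂ)) ξ :=
    Continuous.continuousAt (by fun_prop)
  have c1 := fun s : ℂ => ContinuousAt.comp (f := fun ξ : Space d =>
    ((k ^ 2 * ‖θ - ξ‖ ^ 2 : ℝ) : ℂ)) (x := ξ) (continuousAt_cpow_const (b := s)
      (Or.inl (by rw [Complex.ofReal_re]; positivity))) h1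
  have c2 := fun s : ℂ => ContinuousAt.comp (f := fun ξ : Space d =>
    ((k ^ 2 * |1 - ‖ξ‖ ^ 2| : ℝ) : ℂ)) (x := ξ) (continuousAt_cpow_const (b := s)
      (Or.inl (by rw [Complex.ofReal_re]; positivity))) h2
  exact continuousAt_const.mul ((c1 _).mul (hside.mul (c2 _)))

theorem continuousOn_integral_amplitude (hd : 2 ≤ d) (hk : 0 < lam * k)
    (hf : Integrable f (sphereMeasure d)) :
    ContinuousOn (fun ξ => ∫ θ : Sphere d, amplitude k lam (θ : Space d) ξ * f θ
      ∂(sphereMeasure d)) {ξ | ‖ξ‖ ≠ 1} := by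
  intro ξ hξ
  refine ContinuousAt.continuousWithinAt ?_
  have hk0 : k ≠ 0 := right_ne_zero_of_mul hk.ne'
  have hU : IsOpen {ξ : Space d | ‖ξ‖ ≠ 1} := isOpen_ne_fun continuous_norm continuous_const
  have hB := (continuousOn_amplitudeBound d hk0 lam).continuousAt (hU.mem_nhds hξ)
  -- By continuity of the bound, its value at ξ plus 1 dominates the amplitudes at all nearby
  -- points.
  refine continuousAt_of_dominated
    (bound := fun θ => (amplitudeBound d k lam ‖ξ‖ + 1) * ‖f θ‖) ?_ ?_ (hf.norm.const_mul _) ?_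
  · refine Eventually.of_forall fun η => ?_
    exact ((measurable_amplitude k lam).comp
      (by fun_prop : Measurable fun θ : Sphere d => (θ, η))).aestronglyMeasurable.mul
      hf.aestronglyMeasurable
  · filter_upwards [hU.mem_nhds hξ, hB.eventually_lt_const (lt_add_one _)] with η hη hη2
    refine Eventually.of_forall fun θ => ?_
    rw [norm_mul]
    gcongr
    exact (norm_amplitude_le hd hk (norm_sphere_coe θ) hη).trans hη2.le
  · exact Eventually.of_forall fun θ =>
      (continuousAt_amplitude hk0 (norm_sphere_coe θ) hξ).mul continuousAt_const

/-- The behaviour of the momentum amplitude under inversion in the unit sphere. -/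
theorem amplitude_inversion (hk : k ≠ 0) {θ ξ : Space d} (hθ : ‖θ‖ = 1) (hξ0 : 0 < ‖ξ‖)
    (hξ1 : ‖ξ‖ < 1) :
    amplitude k lam θ ξ = -((Real.exp (-(π * |lam|)) / ‖ξ‖ ^ (d + 1) : ℝ) : ℂ) *
      amplitude k lam θ ((‖ξ‖ ^ 2)⁻¹ • ξ) := by
  have hr2 : 0 < ‖ξ‖ ^ 2 := by positivity
  have hnorm : ‖(‖ξ‖ ^ 2)⁻¹ • ξ‖ = ‖ξ‖⁻¹ := by
    rw [norm_smul, Real.norm_of_nonneg (by positivity)]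
    field_simp
  -- The classical inversion identity for distances to a point of the unit sphere; it uses |θ| = 1.
  have hdist : ‖θ - (‖ξ‖ ^ 2)⁻¹ • ξ‖ ^ 2 = (‖ξ‖ ^ 2)⁻¹ * ‖θ - ξ‖ ^ 2 := by
    rw [norm_sub_sq_real, norm_sub_sq_real, hnorm, hθ, real_inner_smul_right]
    field_simp
    ring
  have hθξ := norm_sub_ne_zero_of_norm_ne hθ hξ1.ne
  have h1 : 0 < 1 - ‖ξ‖ ^ 2 := by nlinarith
  have habs : |1 - ‖(‖ξ‖ ^ 2)⁻¹ • ξ‖ ^ 2| = (‖ξ‖ ^ 2)⁻¹ * |1 - ‖ξ‖ ^ 2| := by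
    rw [hnorm, show 1 - ‖ξ‖⁻¹ ^ 2 = -((‖ξ‖ ^ 2)⁻¹ * (1 - ‖ξ‖ ^ 2)) by field_simp; ring, abs_neg,
      abs_mul, abs_of_pos (inv_pos.2 hr2)]
  have hgt : ¬ ‖(‖ξ‖ ^ 2)⁻¹ • ξ‖ < 1 := by
    rw [hnorm, not_lt]
    exact (one_le_inv₀ hξ0).2 hξ1.le
  have hA : ((k ^ 2 * ‖θ - ξ‖ ^ 2 : ℝ) : ℂ) ≠ 0 := by
    have : k ^ 2 * ‖θ - ξ‖ ^ 2 ≠ 0 := by positivity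
    exact_mod_cast this
  have hD : ((k ^ 2 * |1 - ‖ξ‖ ^ 2| : ℝ) : ℂ) ≠ 0 := by
    have : k ^ 2 * |1 - ‖ξ‖ ^ 2| ≠ 0 := by positivity
    exact_mod_cast this
  have hq : (((‖ξ‖ ^ 2)⁻¹ : ℝ) : ℂ) ≠ 0 := by exact_mod_cast (inv_pos.2 hr2).ne'
  -- The exponents a-b and -a-1 sum to -(d+1)/2, so λ drops out and the base |ξ|⁻² gives |ξ|^{d+1}.
  have hpow : (((‖ξ‖ ^ 2)⁻¹ : ℝ) : ℂ) ^ (Complex.I * lam - (((d : ℝ) - 1) / 2 : ℝ)) *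
      (((‖ξ‖ ^ 2)⁻¹ : ℝ) : ℂ) ^ (-(Complex.I * lam) - 1) = ((‖ξ‖ ^ (d + 1) : ℝ) : ℂ) := by
    rw [← Complex.cpow_add _ _ hq]
    have e : (Complex.I * lam - (((d : ℝ) - 1) / 2 : ℝ) + (-(Complex.I * lam) - 1) : ℂ) =
        ((-(((d + 1 : ℕ) : ℝ) / 2) : ℝ) : ℂ) := by
      push_cast
      ring
    rw [e, ← Complex.ofReal_cpow (by positivity), Real.inv_rpow hr2.le, Real.rpow_neg hr2.le,
      inv_inv, ← Real.rpow_natCast ‖ξ‖ 2, ← Real.rpow_mul hξ0.le, ← Real.rpow_natCast]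
    congr 2
    push_cast
    ring
  have eA : k ^ 2 * ‖θ - (‖ξ‖ ^ 2)⁻¹ • ξ‖ ^ 2 = (‖ξ‖ ^ 2)⁻¹ * (k ^ 2 * ‖θ - ξ‖ ^ 2) := by
    rw [hdist]
    ring
  have eD : k ^ 2 * |1 - ‖(‖ξ‖ ^ 2)⁻¹ • ξ‖ ^ 2| = (‖ξ‖ ^ 2)⁻¹ * (k ^ 2 * |1 - ‖ξ‖ ^ 2|) := by
    rw [habs]
    ring
  rw [amplitude, amplitude, sideFactor, sideFactor, if_pos hξ1, if_neg hgt, eA, eD,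
    Complex.ofReal_mul (‖ξ‖ ^ 2)⁻¹, Complex.ofReal_mul (‖ξ‖ ^ 2)⁻¹,
    ofReal_mul_cpow (inv_pos.2 hr2) hA, ofReal_mul_cpow (inv_pos.2 hr2) hD,
    Complex.ofReal_div (Real.exp _)]
  have hne : ((‖ξ‖ ^ (d + 1) : ℝ) : ℂ) ≠ 0 := by
    have : ‖ξ‖ ^ (d + 1) ≠ 0 := by positivity
    exact_mod_cast this
  generalize ((k ^ 2 * ‖θ - ξ‖ ^ 2 : ℝ) : ℂ) ^ (Complex.I * lam - (((d : ℝ) - 1) / 2 : ℝ)) = X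
  generalize ((k ^ 2 * |1 - ‖ξ‖ ^ 2| : ℝ) : ℂ) ^ (-(Complex.I * lam) - 1) = Y
  rw [← hpow] at hne ⊢
  generalize (((‖ξ‖ ^ 2)⁻¹ : ℝ) : ℂ) ^ (Complex.I * lam - (((d : ℝ) - 1) / 2 : ℝ)) = P at hne ⊢
  generalize (((‖ξ‖ ^ 2)⁻¹ : ℝ) : ℂ) ^ (-(Complex.I * lam) - 1) = Q at hne ⊢
  have hP : P ≠ 0 := left_ne_zero_of_mul hne
  have hQ : Q ≠ 0 := right_ne_zero_of_mul hne
  field_simp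

end Superposition

/-! ### Return to tempered distributions and the semiclassical normalization. -/

theorem exists_isFunction_of_bounded {u : Space d → ℂ} (hu : Continuous u) {C : ℝ}
    (hC : ∀ x, ‖u x‖ ≤ C) : ∃ T : TemperedDistribution (Space d) ℂ, IsFunction T u := by
  have hL : MemLp u ⊤ (volume : Measure (Space d)) :=
    memLp_top_of_bound hu.aestronglyMeasurable C (Eventually.of_forall hC)
  refine ⟨Lp.toTemperedDistribution (hL.toLp u), fun φ => ⟨?_, ?_⟩⟩
  · exact φ.integrable.mul_bdd hu.aestronglyMeasurable (Eventually.of_forall hC)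
  · rw [Lp.toTemperedDistribution_apply]
    refine integral_congr_ae ?_
    filter_upwards [hL.coeFn_toLp] with x hx
    rw [hx, smul_eq_mul]

theorem planeWave_eq (hbar lam : ℝ) (x : Space d) (θ : Sphere d) :
    planeWave d hbar lam x θ =
      (waveConst d hbar lam : ℂ) * coreWave (hbar ^ 2 * lam)⁻¹ lam x θ := by
  have e1 : (inner ℝ x (θ : Space d) : ℝ) / (hbar ^ 2 * lam) =
      (hbar ^ 2 * lam)⁻¹ * inner ℝ x (θ : Space d) := by rw [div_eq_mul_inv, mul_comm]
  have e2 : (‖x‖ - inner ℝ x (θ : Space d)) / (hbar ^ 2 * lam) =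
      parabolicCoord (hbar ^ 2 * lam)⁻¹ (θ : Space d) x := by
    rw [div_eq_mul_inv, mul_comm, parabolicCoord]
  have e3 : ((d : ℂ) - 1) / 2 = ((((d : ℝ) - 1) / 2 : ℝ) : ℂ) := by push_cast; rfl
  rw [planeWave, coreWave, e1, e2, e3, mul_assoc]

theorem poisson_eq (hbar lam : ℝ) (f : Lp ℂ 2 (sphereMeasure d)) (x : Space d) :
    poisson d hbar lam f x =
      (waveConst d hbar lam : ℂ) * superpose (hbar ^ 2 * lam)⁻¹ lam f x := by
  rw [poisson, superpose, ← integral_const_mul]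
  simp_rw [planeWave_eq, mul_assoc]

/-- The substitution ξ = ħλy changes the phase x·y/ħ into kx·ξ with k = 1/(ħ²λ), the wave number of
the plane wave; in these units the singular sphere is |ξ| = 1. -/
theorem schwartzFourier_scale_apply {hbar lam : ℝ} (hpos : 0 < hbar) (hc : hbar * lam ≠ 0)
    (φ : 𝓢(Space d, ℂ)) (x : Space d) :
    schwartzFourier d hbar hpos (schwartzScale d (hbar * lam) hc φ) x =
      (((2 * π * hbar) ^ (-(d : ℝ) / 2) : ℝ) : ℂ) * ((|(hbar * lam) ^ d|⁻¹ : ℝ) : ℂ) *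
        ∫ ξ, φ ξ * character (hbar ^ 2 * lam)⁻¹ x ξ := by
  rw [schwartzFourier_apply]
  refine Eq.trans ?_ (mul_assoc _ _ _).symm
  congr 1
  have h := Measure.integral_comp_smul (volume : Measure (Space d))
    (fun ξ => φ ξ * character (hbar ^ 2 * lam)⁻¹ x ξ) (hbar * lam)
  rw [finrank_euclideanSpace_fin, Complex.real_smul, ← abs_inv] at *
  rw [← h]
  congr 1
  funext y
  rw [schwartzScale_apply, character, inner_smul_right, real_inner_comm x y]
  congr 2
  have h1 : (hbar : ℂ) ≠ 0 := by exact_mod_cast hpos.ne'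
  have h2 : (lam : ℂ) ≠ 0 := by exact_mod_cast right_ne_zero_of_mul hc
  push_cast
  field_simp

end Coulomb

theorem mainTheorem5 (d : ℕ) (hd : 2 ≤ d) (hbar lam : ℝ) (hhbar : 0 < hbar) (hlam : lam ≠ 0)
    (ψ : Coulomb.Space d → ℂ) (hψ : ψ ∈ Coulomb.eigenspace d hbar lam) :
    ∃ T : TemperedDistribution (Coulomb.Space d) ℂ, Coulomb.IsFunction T ψ ∧
      ∃ g : Coulomb.Space d → ℂ,
        Coulomb.EqOnOpen
          (Coulomb.dilation d (hbar * lam) (mul_ne_zero hhbar.ne' hlam)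
            (Coulomb.semiclassicalFourier d hbar hhbar T)) g {ξ | ‖ξ‖ ≠ 1} ∧
        ∀ ξ : Coulomb.Space d, 0 < ‖ξ‖ → ‖ξ‖ < 1 →
          g ξ = -((Real.exp (-(Real.pi * |lam|)) / ‖ξ‖ ^ (d + 1) : ℝ) : ℂ)
            * g ((‖ξ‖ ^ 2)⁻¹ • ξ) := by
  obtain ⟨f, rfl⟩ := hψ
  set k : ℝ := (hbar ^ 2 * lam)⁻¹ with hkdef
  have hc : hbar * lam ≠ 0 := mul_ne_zero hhbar.ne' hlam
  have hk : 0 < lam * k := by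
    have : lam * k = (hbar ^ 2)⁻¹ := by rw [hkdef]; field_simp
    rw [this]
    positivity
  -- The sphere has finite measure, so L² data are integrable, which is all that is used.
  have hf : Integrable f (Coulomb.sphereMeasure d) :=
    (Lp.memLp f).integrable (by norm_num)
  have hpoisson : Coulomb.poisson d hbar lam f =
      fun x => (Coulomb.waveConst d hbar lam : ℂ) * Coulomb.superpose k lam f x :=
    funext fun x => Coulomb.poisson_eq hbar lam f x
  have hcont : Continuous (Coulomb.poisson d hbar lam f) := by
    rw [hpoisson]
    exact continuous_const.mul (Coulomb.continuous_superpose hd hk hf)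
  obtain ⟨T, hT⟩ := Coulomb.exists_isFunction_of_bounded hcont
    (C := ‖(Coulomb.waveConst d hbar lam : ℂ)‖ *
      (‖(Complex.Gamma (((d : ℝ) - 1) / 2 : ℝ))⁻¹‖ * ∫ θ, ‖f θ‖ ∂(Coulomb.sphereMeasure d)))
    (fun x => by
      rw [hpoisson, norm_mul]
      gcongr
      exact Coulomb.norm_superpose_le hd hk hf x)
  set N : ℂ := (((2 * π * hbar) ^ (-(d : ℝ) / 2) : ℝ) : ℂ) * ((|(hbar * lam) ^ d|⁻¹ : ℝ) : ℂ)
    with hN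
  have hN0 : N ≠ 0 := by
    have h1 : (2 * π * hbar) ^ (-(d : ℝ) / 2) ≠ 0 := by positivity
    have h2 : |(hbar * lam) ^ d|⁻¹ ≠ 0 := by positivity
    exact mul_ne_zero (Complex.ofReal_ne_zero.2 h1) (Complex.ofReal_ne_zero.2 h2)
  -- The constants are, in order, the dilation's normalization, the Fourier normalization with the
  -- Jacobian of the scaling, and that of the plane wave; the rest is the superposed amplitude.
  refine ⟨T, hT, fun ξ => ((|hbar * lam| ^ ((d : ℝ) / 2) : ℝ) : ℂ) * N *
    (Coulomb.waveConst d hbar lam : ℂ) * ((Coulomb.subordConst d : ℂ) *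
      ∫ θ : Coulomb.Sphere d, Coulomb.amplitude k lam (θ : Coulomb.Space d) ξ * f θ
        ∂(Coulomb.sphereMeasure d)), ⟨?_, ?_⟩, ?_⟩
  · exact continuousOn_const.mul (continuousOn_const.mul
      (Coulomb.continuousOn_integral_amplitude hd hk hf))
  · intro φ hφc hφs
    have hΦ : ∀ x, Coulomb.schwartzFourier d hbar hhbar
        (Coulomb.schwartzScale d (hbar * lam) hc φ) x =
        N * ∫ ξ, φ ξ * Coulomb.character k x ξ := fun x =>
      Coulomb.schwartzFourier_scale_apply hhbar hc φ x
    -- Up to the nonzero constant N this function is the transform of a Schwartz function, hence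
    -- Schwartz.
    have hΦi : Integrable fun x => ∫ ξ, φ ξ * Coulomb.character k x ξ := by
      have h := (Coulomb.schwartzFourier d hbar hhbar
        (Coulomb.schwartzScale d (hbar * lam) hc φ)).integrable (μ := volume)
      refine (h.const_mul N⁻¹).congr (Filter.Eventually.of_forall fun x => ?_)
      simp only [hΦ]
      rw [inv_mul_cancel_left₀ hN0]
    have h1 : Coulomb.dilation d (hbar * lam) hc (Coulomb.semiclassicalFourier d hbar hhbar T) φ =
        ((|hbar * lam| ^ ((d : ℝ) / 2) : ℝ) : ℂ) * T (Coulomb.schwartzFourier d hbar hhbar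
          (Coulomb.schwartzScale d (hbar * lam) hc φ)) := rfl
    rw [h1, (hT _).2]
    have h2 := Coulomb.integral_superpose_mul hd hk hf φ.continuous hφc hφs hΦi
    have e1 : ∀ x, Coulomb.schwartzFourier d hbar hhbar
        (Coulomb.schwartzScale d (hbar * lam) hc φ) x * Coulomb.poisson d hbar lam f x =
        N * (Coulomb.waveConst d hbar lam : ℂ) *
          (Coulomb.superpose k lam f x * ∫ ξ, φ ξ * Coulomb.character k x ξ) := by
      intro x
      rw [hΦ, hpoisson]
      ring
    simp_rw [e1]
    rw [integral_const_mul, h2, ← integral_const_mul, ← integral_const_mul]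
    congr 1
    funext ξ
    ring
  · intro ξ h0 h1
    have e : ∀ θ : Coulomb.Sphere d, Coulomb.amplitude k lam (θ : Coulomb.Space d) ξ * f θ =
        -((Real.exp (-(Real.pi * |lam|)) / ‖ξ‖ ^ (d + 1) : ℝ) : ℂ) *
          (Coulomb.amplitude k lam (θ : Coulomb.Space d) ((‖ξ‖ ^ 2)⁻¹ • ξ) * f θ) := by
      intro θ
      rw [Coulomb.amplitude_inversion (right_ne_zero_of_mul hk.ne') (Coulomb.norm_sphere_coe θ)
        h0 h1, mul_assoc]
    simp_rw [e]
    rw [integral_const_mul]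
    ring
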